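/- **Theorem (Fréchet differentiability of the control-to-state map).** Let $D\subset\mathbb R^d$ be a bounded domain, $T>0$, and let $\mathcal L$ be a densely defined, self-adjoint, positive definite linear operator on $L^2(D)$ with compact inverse. Let $(e_j)_{j\in\mathbb N}$ be an orthonormal basis of $L^2(D)$ with $\mathcal L e_j=\lambda_j e_j$, $0<\lambda_1\le\lambda_2\le\dots$. Let $Q$ be a bounded, self-adjoint, positive semidefinite operator on $L^2(D)$ with $Qe_j=\mu_je_j$ and $\sum_j\mu_j<\infty$. On a probability space $(\Omega,\mathcal F,\mathbb P)$ with a normal filtration $(\mathcal F_t)_{t\in[0,T]}$ let $W=\sum_j\sqrt{\mu_j}\,B_j e_j$ be an $L^2(D)$-valued $Q$-Wiener process on $[0,T]$, where $\sqrt{\mu_j}B_j=\langle W,e_j\rangle$. Let $y_0\in L^2(D)$ be deterministic. For $s>0$ and $j\in\mathbb N$ let $y_j(s,\cdot)$ be the adapted solution, with continuous paths, of $$y_j(s,t)=\langle y_0,e_j\rangle-\int_0^t\lambda_j^s\,y_j(s,\tau)\,d\tau+\sqrt{\mu_j}\,B_j(t),\qquad t\in[0,T],$$ that is, of $dy_j=-\lambda_j^sy_j\,dt+\sqrt{\mu_j}\,dB_j$,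 $y_j(s,0)=\langle y_0,e_j\rangle$, where the solutions are taken pathwise: outside a single null set of $\omega$, the paths are continuous and the equation holds for all $s>0$, all $j$ and all $t\in[0,T]$. Then: 1. Such a family $(y_j(s,\cdot))_{s>0,\,j\in\mathbb N}$ exists. 2. For any such family and for almost every $\omega$: for all $j$ and $t\in[0,T]$ the map $s\mapsto y_j(s,t)$ is twice differentiable on $(0,\infty)$; for every $s>0$ the series $$y(s)=\sum_jy_j(s,\cdot)e_j,\qquad \partial_sy(s)=\sum_j\partial_sy_j(s,\cdot)e_j,\qquad \partial_{ss}^2y(s)=\sum_j\partial_{ss}^2y_j(s,\cdot)e_j$$ converge in $L^2(D\times[0,T])$; and the map $\mathcal S(\omega):(0,\infty)\to L^2(D\times[0,T])$, $s\mapsto y(s)$, is twice Fréchet differentiable at every $\bar s\in(0,\infty)$, with $$\mathcal D_s\mathcal S(\bar s)(h)=h\,\partial_sy(\bar s),\qquad \mathcal D^2_{ss}\mathcal S(\bar s)(h)(\tilde h)=h\tilde h\,\partial^2_{ss}y(\bar s)\qquad (h,\tilde h\in\mathbb R).$$ -/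

import Mathlib

open MeasureTheory ProbabilityTheory Set Filter Topology
open scoped RealInnerProductSpace

noncomputable section

/-- The real Hilbert space `L²(D)` for a subset `D` of `ℝᵈ` with Lebesgue measure. -/
abbrev SpaceL2 {d : ℕ} (D : Set (EuclideanSpace ℝ (Fin d))) : Type :=
  Lp ℝ 2 ((volume : Measure (EuclideanSpace ℝ (Fin d))).restrict D)

/-- Lebesgue measure on the space-time cylinder `D × [0,T]`. -/
abbrev cylinderMeasure {d : ℕ} (D : Set (EuclideanSpace ℝ (Fin d))) (T : ℝ) :
    Measure (EuclideanSpace ℝ (Fin d) × ℝ) :=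
  ((volume : Measure (EuclideanSpace ℝ (Fin d))).restrict D).prod
    ((volume : Measure ℝ).restrict (Icc 0 T))

/-- The real Hilbert space `L²(D × [0,T])`. -/
abbrev CylinderL2 {d : ℕ} (D : Set (EuclideanSpace ℝ (Fin d))) (T : ℝ) : Type :=
  Lp ℝ 2 (cylinderMeasure D T)

/-- Densely defined, self-adjoint, positive definite operators (in general unbounded) with
compact inverse. -/
structure IsPositiveWithCompactInverse {H : Type*} [NormedAddCommGroup H]
    [InnerProductSpace ℝ H] [CompleteSpace H] (A : H →ₗ.[ℝ] H) : Prop where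
  dense_domain : Dense (A.domain : Set H)
  selfAdjoint : IsSelfAdjoint A
  positive : ∀ v : A.domain, (v : H) ≠ 0 → 0 < ⟪A v, (v : H)⟫
  compact_inverse : ∃ K : H →L[ℝ] H, IsCompactOperator K ∧ (∀ v : A.domain, K (A v) = v) ∧
    ∀ w : H, ∃ v : A.domain, (v : H) = K w ∧ A v = w

/-- `e` is an orthonormal basis made of eigenvectors of `A`, and `lam` is the nondecreasing
sequence of the corresponding eigenvalues. -/
structure IsEigenbasis {H : Type*} [NormedAddCommGroup H] [InnerProductSpace ℝ H]
    (A : H →ₗ.[ℝ] H) (e : HilbertBasis ℕ ℝ H) (lam : ℕ → ℝ) : Prop where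
  apply_eq : ∀ j, ∃ h : e j ∈ A.domain, A ⟨e j, h⟩ = lam j • e j
  monotone : Monotone lam

/-- A filtration is normal on `[0,T]` if it is right-continuous there and `ℱ 0` contains all
null events. -/
structure IsNormalFiltration {Ω : Type*} {mΩ : MeasurableSpace Ω} (ℱ : Filtration ℝ mΩ)
    (P : Measure Ω) (T : ℝ) : Prop where
  right_continuous : ∀ t ∈ Ico 0 T, (ℱ t : MeasurableSpace Ω) = ⨅ r ∈ Ioc t T, ℱ r
  null_sets : ∀ A : Set Ω, MeasurableSet A → P A = 0 → MeasurableSet[ℱ 0] A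

/-- `Q`-Wiener processes on `[0,T]` with respect to the filtration `ℱ`. That the increment over
`[r,t]` is centred Gaussian with covariance operator `(t - r) Q` is expressed through its
one-dimensional projections. -/
structure IsQWienerProcess {H : Type*} [NormedAddCommGroup H] [InnerProductSpace ℝ H]
    {Ω : Type*} {mΩ : MeasurableSpace Ω} (Q : H →L[ℝ] H) (T : ℝ) (ℱ : Filtration ℝ mΩ)
    (P : Measure Ω) (W : ℝ → Ω → H) : Prop where
  adapted : ∀ t ∈ Icc 0 T, StronglyMeasurable[ℱ t] (W t)
  initial : ∀ᵐ ω ∂P, W 0 ω = 0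
  continuous_paths : ∀ᵐ ω ∂P, ContinuousOn (fun t => W t ω) (Icc 0 T)
  indep_increments : ∀ r t, 0 ≤ r → r < t → t ≤ T →
    Indep (MeasurableSpace.comap (fun ω => W t ω - W r ω) (borel H)) (ℱ r) P
  gaussian_increments : ∀ r t, 0 ≤ r → r < t → t ≤ T → ∀ v : H,
    P.map (fun ω => ⟪W t ω - W r ω, v⟫) = gaussianReal 0 ((t - r) * ⟪Q v, v⟫).toNNReal

/-- The real Brownian motion `B_j = ⟨W, e_j⟩ / √μ_j`, so that `W = ∑ √μ_j B_j e_j`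
(for `μ_j = 0` the `j`-th term vanishes, and the value of `B_j` plays no role). -/
def coordinateBM {H : Type*} [NormedAddCommGroup H] [InnerProductSpace ℝ H] {Ω : Type*}
    (e : HilbertBasis ℕ ℝ H) (μ : ℕ → ℝ) (W : ℝ → Ω → H) (j : ℕ) (t : ℝ) (ω : Ω) : ℝ :=
  ⟪e j, W t ω⟫ / √(μ j)

/-- The family `y j s t ω` consists of the strong solutions on `[0,T]` of the Itô equations
`dy_j = - λ_j^s y_j dt + √μ_j dB_j`, `y_j(0) = ⟨e_j, y₀⟩`: adapted processes which almost surely,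
for all `s > 0` and all `j`, have continuous paths and satisfy the equation in integral form
(the noise being additive, `∫₀ᵗ √μ_j dB_j = √μ_j B_j(t)`). -/
structure IsModeFamily {H : Type*} [NormedAddCommGroup H] [InnerProductSpace ℝ H]
    {Ω : Type*} {mΩ : MeasurableSpace Ω} (e : HilbertBasis ℕ ℝ H) (lam μ : ℕ → ℝ) (y₀ : H)
    (T : ℝ) (ℱ : Filtration ℝ mΩ) (P : Measure Ω) (W : ℝ → Ω → H)
    (y : ℕ → ℝ → ℝ → Ω → ℝ) : Prop where
  adapted : ∀ j s, 0 < s → ∀ t ∈ Icc 0 T, StronglyMeasurable[ℱ t] (y j s t)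
  solves : ∀ᵐ ω ∂P, ∀ s, 0 < s → ∀ j,
    ContinuousOn (fun t => y j s t ω) (Icc 0 T) ∧
    ∀ t ∈ Icc 0 T, y j s t ω =
      ⟪e j, y₀⟫ - (∫ τ in (0 : ℝ)..t, lam j ^ s * y j s τ ω) + √(μ j) * coordinateBM e μ W j t ω

/-- `z(x,t) = ∑_j f_j(t) e_j(x)`, a series of elements of `L²(D × [0,T])` converging there. -/
def IsEigenSeries {d : ℕ} {D : Set (EuclideanSpace ℝ (Fin d))} {T : ℝ}
    (e : HilbertBasis ℕ ℝ (SpaceL2 D)) (f : ℕ → ℝ → ℝ) (z : CylinderL2 D T) : Prop :=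
  ∃ h : ∀ j, MemLp (fun p : EuclideanSpace ℝ (Fin d) × ℝ => f j p.2 * e j p.1) 2
      (cylinderMeasure D T),
    HasSum (fun j => (h j).toLp) z

end

/-! Each mode solves a scalar linear equation with additive noise and can be treated path by path.
Put a = λ_j^s = exp(s l) with l = log λ_j, and let b be the noise path, equal to 0 for t ≤ 0.
Variation of constants and ∫₀^∞ a e^{-aσ} dσ = 1 give y_j(t) = c e^{-at} + ∫₀^∞ a e^{-aσ} (b(t) -
b(t-σ)) dσ (`duhamel_eq_modeDeriv`). Here s enters only through a, and ∂_s is l times a d/da. So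
every s-derivative has the same shape, with a factor l^n and with e^{-x} replaced by (x d/dx)ⁿ
e^{-x} (`hasDerivAt_modeDeriv`).

The difficulty is to sum over j outside a single null set valid for all s. Cauchy–Schwarz with the
weight σ^{3/2} bounds the n-th derivative by C |l|^n e^{-sl/4} (|c| t^{-1/4} + √E_j(t)), where E_j
is the `pathEnergy` of b (`exists_abs_modeDeriv_le`). Since the λ_j are bounded away from 0, |log
λ_j|^n λ_j^{-s/4} is bounded uniformly in j and in s from a compact part of (0,∞). The remaining
factor depends neither on s nor on n, and its squared L²(0,T) norms are almost surely summable,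
because the expected energy of the j-th path is at most a constant times μ_j
(`IsQWienerProcess.ae_tsum_lintegral_energy_ne_top`).

A second-order Taylor bound for each mode can therefore be summed in the orthogonal sum of copies of
L²(0,T), which differentiates the series (`exists_hasDerivAt_orthogonal_series`). -/

/-! ### The functions (x d/dx)ⁿ e⁻ˣ and their decay -/

open Polynomial in
/-- The polynomials `p n` with `(x d/dx)ⁿ e⁻ˣ = p n (x) e⁻ˣ`. -/
noncomputable def heatPoly : ℕ → Polynomial ℝ
  | 0 => 1
  | n + 1 => X * (derivative (heatPoly n) - heatPoly n)

/-- The function `(x d/dx)ⁿ e⁻ˣ`. -/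
noncomputable def heatFn (n : ℕ) (x : ℝ) : ℝ := (heatPoly n).eval x * Real.exp (-x)

/-- The derivative of `heatFn n`. -/
noncomputable def heatKer (n : ℕ) (x : ℝ) : ℝ :=
  (Polynomial.derivative (heatPoly n) - heatPoly n).eval x * Real.exp (-x)

theorem hasDerivAt_polynomial_mul_exp_neg (p : Polynomial ℝ) (x : ℝ) :
    HasDerivAt (fun x => p.eval x * Real.exp (-x))
      ((Polynomial.derivative p - p).eval x * Real.exp (-x)) x := by
  have h := (p.hasDerivAt x).mul (hasDerivAt_neg x).exp
  refine h.congr_deriv ?_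
  simp only [Polynomial.eval_sub]
  ring

theorem hasDerivAt_heatFn (n : ℕ) (x : ℝ) : HasDerivAt (heatFn n) (heatKer n x) x :=
  hasDerivAt_polynomial_mul_exp_neg _ x

theorem heatFn_succ (n : ℕ) (x : ℝ) : heatFn (n + 1) x = x * heatKer n x := by
  simp only [heatFn, heatKer, heatPoly, Polynomial.eval_mul, Polynomial.eval_X]
  ring

/-- This is the product rule for `heatFn (n + 1) x = x * heatKer n x`. It makes ∂_s of a · `heatKer
n` (aσ), with a = exp(s l), equal to l times the same expression for n + 1. -/
theorem exists_hasDerivAt_heatKer (n : ℕ) (x : ℝ) :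
    ∃ d, HasDerivAt (heatKer n) d x ∧ heatKer (n + 1) x = heatKer n x + x * d := by
  refine ⟨_, hasDerivAt_polynomial_mul_exp_neg _ x, ?_⟩
  simp only [heatKer, heatPoly, Polynomial.eval_mul, Polynomial.eval_X, Polynomial.eval_sub,
    Polynomial.derivative_mul, Polynomial.derivative_X, Polynomial.eval_add, Polynomial.derivative_sub,
    Polynomial.eval_one]
  ring

@[fun_prop]
theorem continuous_heatFn (n : ℕ) : Continuous (heatFn n) := by
  unfold heatFn; fun_prop

@[fun_prop]
theorem continuous_heatKer (n : ℕ) : Continuous (heatKer n) := by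
  unfold heatKer; fun_prop

theorem heatFn_zero (x : ℝ) : heatFn 0 x = Real.exp (-x) := by simp [heatFn, heatPoly]

theorem heatKer_zero (x : ℝ) : heatKer 0 x = -Real.exp (-x) := by simp [heatKer, heatPoly]

theorem exists_abs_polynomial_eval_le (p : Polynomial ℝ) :
    ∃ C, 0 ≤ C ∧ ∀ x, 0 ≤ x → |p.eval x| ≤ C * Real.exp (x / 2) := by
  induction p using Polynomial.induction_on' with
  | add p q hp hq =>
    obtain ⟨C, hC, h⟩ := hp
    obtain ⟨C', hC', h'⟩ := hq
    refine ⟨C + C', by positivity, fun x hx => ?_⟩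
    rw [Polynomial.eval_add, add_mul]
    exact (abs_add_le _ _).trans (add_le_add (h x hx) (h' x hx))
  | monomial n a =>
    refine ⟨|a| * (2 ^ n * n.factorial), by positivity, fun x hx => ?_⟩
    have h := Real.pow_div_factorial_le_exp (x := x / 2) (by positivity) n
    rw [div_le_iff₀ (by positivity), div_pow, div_le_iff₀ (by positivity)] at h
    rw [Polynomial.eval_monomial, abs_mul, abs_of_nonneg (pow_nonneg hx n), mul_assoc]
    refine mul_le_mul_of_nonneg_left (h.trans (le_of_eq ?_)) (abs_nonneg a)
    ring

theorem exists_abs_polynomial_mul_exp_neg_le (p : Polynomial ℝ) :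
    ∃ C, 0 ≤ C ∧ ∀ x, 0 ≤ x → |p.eval x * Real.exp (-x)| ≤ C * Real.exp (-(x / 2)) := by
  obtain ⟨C, hC, h⟩ := exists_abs_polynomial_eval_le p
  refine ⟨C, hC, fun x hx => ?_⟩
  rw [abs_mul, Real.abs_exp]
  refine (mul_le_mul_of_nonneg_right (h x hx) (Real.exp_pos _).le).trans (le_of_eq ?_)
  rw [mul_assoc, ← Real.exp_add]
  congr 2
  ring

theorem exists_abs_heatFn_le (n : ℕ) :
    ∃ C, 0 ≤ C ∧ ∀ x, 0 ≤ x → |heatFn n x| ≤ C * Real.exp (-(x / 2)) :=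
  exists_abs_polynomial_mul_exp_neg_le _

theorem exists_abs_heatKer_le (n : ℕ) :
    ∃ C, 0 ≤ C ∧ ∀ x, 0 ≤ x → |heatKer n x| ≤ C * Real.exp (-(x / 2)) :=
  exists_abs_polynomial_mul_exp_neg_le _

/-! ### Differentiating a single mode in s -/

/-- The `n`-th derivative in `s` of the solution at time `t` of `dy = - e^{sl} y dt + db`,
`y(0) = c`, for a path `b` vanishing at nonpositive times. -/
noncomputable def modeDeriv (l c : ℝ) (b : ℝ → ℝ) (n : ℕ) (s t : ℝ) : ℝ :=
  l ^ n * (c * heatFn n (Real.exp (s * l) * t) -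
    ∫ σ in Ioi (0 : ℝ), Real.exp (s * l) * heatKer n (Real.exp (s * l) * σ) * (b t - b (t - σ)))

theorem hasDerivAt_exp_mul (l s : ℝ) :
    HasDerivAt (fun s => Real.exp (s * l)) (l * Real.exp (s * l)) s := by
  have := ((hasDerivAt_id s).mul_const l).exp
  simpa [mul_comm] using this

theorem hasDerivAt_heatFn_comp (l : ℝ) (n : ℕ) (s t : ℝ) :
    HasDerivAt (fun s => heatFn n (Real.exp (s * l) * t))
      (l * heatFn (n + 1) (Real.exp (s * l) * t)) s := by
  refine ((hasDerivAt_heatFn n _).comp s ((hasDerivAt_exp_mul l s).mul_const t)).congr_deriv ?_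
  rw [heatFn_succ]
  ring

theorem hasDerivAt_heatKer_comp (l : ℝ) (n : ℕ) (s σ : ℝ) :
    HasDerivAt (fun s => Real.exp (s * l) * heatKer n (Real.exp (s * l) * σ))
      (l * (Real.exp (s * l) * heatKer (n + 1) (Real.exp (s * l) * σ))) s := by
  obtain ⟨d, hd, e⟩ := exists_hasDerivAt_heatKer n (Real.exp (s * l) * σ)
  refine ((hasDerivAt_exp_mul l s).mul
    (hd.comp s ((hasDerivAt_exp_mul l s).mul_const σ))).congr_deriv ?_
  rw [e]
  simp only [Function.comp]
  ring

theorem abs_exp_mul_heatKer_le {n : ℕ} {C : ℝ} (hC : 0 ≤ C)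
    (h : ∀ x, 0 ≤ x → |heatKer n x| ≤ C * Real.exp (-(x / 2))) {l R s σ : ℝ} (hs : |s| ≤ R)
    (hσ : 0 ≤ σ) :
    |Real.exp (s * l) * heatKer n (Real.exp (s * l) * σ)| ≤
      Real.exp (R * |l|) * C * Real.exp (-(Real.exp (-(R * |l|)) / 2) * σ) := by
  have h1 : |s * l| ≤ R * |l| := by
    rw [abs_mul]; exact mul_le_mul_of_nonneg_right hs (abs_nonneg l)
  obtain ⟨h2, h3⟩ := abs_le.1 h1
  rw [abs_mul, Real.abs_exp, mul_assoc]
  refine mul_le_mul (Real.exp_le_exp.2 h3) ((h _ (by positivity)).trans ?_) (abs_nonneg _)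
    (Real.exp_pos _).le
  refine mul_le_mul_of_nonneg_left (Real.exp_le_exp.2 ?_) hC
  have := mul_le_mul_of_nonneg_right (Real.exp_le_exp.2 h2) hσ
  linarith

/-- For s in a bounded set, exp(s l) stays between two positive constants, so the kernel has an
exponentially decaying majorant in σ. Boundedness of b then suffices to differentiate under the
integral, at every t and without finite energy. -/
theorem hasDerivAt_modeDeriv {b : ℝ → ℝ} (hb : Continuous b) {M : ℝ} (hM : ∀ t, |b t| ≤ M)
    (l c : ℝ) (n : ℕ) (s t : ℝ) :
    HasDerivAt (fun s => modeDeriv l c b n s t) (modeDeriv l c b (n + 1) s t) s := by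
  obtain ⟨C, hC, hCb⟩ := exists_abs_heatKer_le n
  obtain ⟨C', hC', hCb'⟩ := exists_abs_heatKer_le (n + 1)
  set R := |s| + 1 with hR
  have hΔ : ∀ σ, |b t - b (t - σ)| ≤ 2 * M := fun σ =>
    (abs_sub _ _).trans (by linarith [hM t, hM (t - σ)])
  have hexp : ∀ K : ℝ, IntegrableOn
      (fun σ => K * Real.exp (-(Real.exp (-(R * |l|)) / 2) * σ) * (2 * M)) (Ioi 0) := fun K =>
    ((integrableOn_exp_mul_Ioi (neg_lt_zero.2 (by positivity)) 0).const_mul K).mul_const (2 * M)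
  have hI := hasDerivAt_integral_of_dominated_loc_of_deriv_le
    (μ := volume.restrict (Ioi (0 : ℝ)))
    (F := fun s σ => Real.exp (s * l) * heatKer n (Real.exp (s * l) * σ) * (b t - b (t - σ)))
    (F' := fun s σ => l * (Real.exp (s * l) * heatKer (n + 1) (Real.exp (s * l) * σ)) *
      (b t - b (t - σ)))
    (bound := fun σ => |l| * (Real.exp (R * |l|) * C') *
      Real.exp (-(Real.exp (-(R * |l|)) / 2) * σ) * (2 * M))
    (Metric.ball_mem_nhds s one_pos)
    (Eventually.of_forall fun s => Continuous.aestronglyMeasurable (by fun_prop))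
    (by
      refine (hexp (Real.exp (R * |l|) * C)).mono' (Continuous.aestronglyMeasurable (by fun_prop))
        ((ae_restrict_mem measurableSet_Ioi).mono fun σ hσ => ?_)
      rw [norm_mul, Real.norm_eq_abs, Real.norm_eq_abs]
      exact mul_le_mul (abs_exp_mul_heatKer_le hC hCb (by simp [hR]) hσ.le) (hΔ σ) (abs_nonneg _)
        (by positivity))
    (Continuous.aestronglyMeasurable (by fun_prop))
    ((ae_restrict_mem measurableSet_Ioi).mono fun σ hσ r hr => by
      have hr' : |r| ≤ R := by
        have h1 : |r - s| < 1 := by simpa [Real.dist_eq] using hr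
        have h2 := abs_add_le (r - s) s
        rw [sub_add_cancel] at h2
        linarith
      rw [norm_mul, norm_mul, Real.norm_eq_abs, Real.norm_eq_abs, Real.norm_eq_abs]
      refine mul_le_mul ?_ (hΔ σ) (abs_nonneg _) (by positivity)
      rw [mul_assoc |l|]
      exact mul_le_mul_of_nonneg_left (abs_exp_mul_heatKer_le hC' hCb' hr' hσ.le) (abs_nonneg l))
    (hexp _)
    (Eventually.of_forall fun σ r _ => (hasDerivAt_heatKer_comp l n r σ).mul_const _)
  refine ((((hasDerivAt_heatFn_comp l n s t).const_mul c).sub hI.2).const_mul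
    (l ^ n)).congr_deriv ?_
  simp only [modeDeriv, mul_assoc, integral_const_mul]
  ring

theorem measurable_modeDeriv {b : ℝ → ℝ} (hb : Continuous b) (l c : ℝ) (n : ℕ) (s : ℝ) :
    Measurable (modeDeriv l c b n s) := by
  have h : StronglyMeasurable fun t => ∫ σ in Ioi (0 : ℝ),
      Real.exp (s * l) * heatKer n (Real.exp (s * l) * σ) * (b t - b (t - σ)) := by
    refine StronglyMeasurable.integral_prod_right (f := fun t σ =>
      Real.exp (s * l) * heatKer n (Real.exp (s * l) * σ) * (b t - b (t - σ))) ?_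
    apply Continuous.stronglyMeasurable
    unfold Function.uncurry
    fun_prop
  unfold modeDeriv
  refine Measurable.const_mul (Measurable.sub ?_ h.measurable) _
  exact Continuous.measurable (by fun_prop)

/-! ### Bounds on the modes in terms of the path energy -/

/-- The energy `∫₀^∞ σ^{-3/2} (b(t) - b(t-σ))² dσ`, measuring the regularity of `b` at time `t`. -/
noncomputable def pathEnergy (b : ℝ → ℝ) (t : ℝ) : ℝ :=
  ∫ σ in Ioi (0 : ℝ), σ ^ (-(3 / 2) : ℝ) * (b t - b (t - σ)) ^ 2

theorem integral_sq_exp_mul_heatKer_le {n : ℕ} {C : ℝ}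
    (h : ∀ x, 0 ≤ x → |heatKer n x| ≤ C * Real.exp (-(x / 2))) {a : ℝ} (ha : 0 < a) :
    IntegrableOn (fun σ => (σ ^ (3 / 4 : ℝ) * |a * heatKer n (a * σ)|) ^ 2) (Ioi 0) ∧
    ∫ σ in Ioi (0 : ℝ), (σ ^ (3 / 4 : ℝ) * |a * heatKer n (a * σ)|) ^ 2 ≤
      C ^ 2 * Real.Gamma (5 / 2) * a ^ (-(1 / 2) : ℝ) := by
  have hb : ∀ σ ∈ Ioi (0 : ℝ), (σ ^ (3 / 4 : ℝ) * |a * heatKer n (a * σ)|) ^ 2 ≤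
      (a * C) ^ 2 * (σ ^ (5 / 2 - 1 : ℝ) * Real.exp (-(a * σ))) := by
    intro σ hσ
    have hσ' : (0 : ℝ) < σ := hσ
    have h1 := h (a * σ) (by positivity)
    have h2 : (σ ^ (3 / 4 : ℝ)) ^ 2 = σ ^ (5 / 2 - 1 : ℝ) := by
      rw [← Real.rpow_natCast, ← Real.rpow_mul hσ'.le]; norm_num
    have h3 : Real.exp (-(a * σ / 2)) ^ 2 = Real.exp (-(a * σ)) := by
      rw [← Real.exp_nat_mul]; congr 1; push_cast; ring
    rw [abs_mul, abs_of_pos ha, mul_pow, mul_pow, h2]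
    calc _ ≤ σ ^ (5 / 2 - 1 : ℝ) * (a ^ 2 * (C * Real.exp (-(a * σ / 2))) ^ 2) := by gcongr
      _ = _ := by rw [mul_pow, h3]; ring
  have hI : IntegrableOn (fun σ : ℝ => (a * C) ^ 2 *
      (σ ^ (5 / 2 - 1 : ℝ) * Real.exp (-(a * σ)))) (Ioi 0) := by
    refine Integrable.const_mul ?_ _
    have := integrableOn_rpow_mul_exp_neg_mul_rpow (p := 1) (s := 5 / 2 - 1) (by norm_num)
      one_pos ha
    simp only [Real.rpow_one, neg_mul] at this
    exact this
  have hI' : IntegrableOn (fun σ => (σ ^ (3 / 4 : ℝ) * |a * heatKer n (a * σ)|) ^ 2) (Ioi 0) := by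
    refine hI.mono' (Measurable.aestronglyMeasurable ?_)
      ((ae_restrict_mem measurableSet_Ioi).mono fun σ hσ => ?_)
    · have := (continuous_heatKer n).measurable
      fun_prop
    · rw [Real.norm_of_nonneg (by positivity)]
      exact hb σ hσ
  refine ⟨hI', (setIntegral_mono_on hI' hI measurableSet_Ioi hb).trans (le_of_eq ?_)⟩
  rw [integral_const_mul, Real.integral_rpow_mul_exp_neg_mul_Ioi (by norm_num) ha, one_div,
    Real.inv_rpow ha.le, ← Real.rpow_neg ha.le, mul_pow, ← Real.rpow_natCast a 2]
  have : a ^ (-(1 / 2) : ℝ) = a ^ ((2 : ℕ) : ℝ) * a ^ (-(5 / 2) : ℝ) := by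
    rw [← Real.rpow_add ha]; norm_num
  rw [this]
  ring

/-- Cauchy–Schwarz after inserting σ^{3/4} σ^{-3/4} = 1. By scaling, the kernel contributes the
square root of a multiple of a^{-1/2}. A weight σ^{-(1+θ)} would yield a^{-θ/2}; any θ > 0 gives
decay in a, while θ < 1 is needed for Brownian paths to have finite energy. Here θ = 1/2. -/
theorem abs_integral_heatKer_mul_le {n : ℕ} {C : ℝ} (hC : 0 ≤ C)
    (h : ∀ x, 0 ≤ x → |heatKer n x| ≤ C * Real.exp (-(x / 2))) {a : ℝ} (ha : 0 < a)
    {b : ℝ → ℝ} (hb : Continuous b) {t : ℝ}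
    (hE : IntegrableOn (fun σ => σ ^ (-(3 / 2) : ℝ) * (b t - b (t - σ)) ^ 2) (Ioi 0)) :
    |∫ σ in Ioi (0 : ℝ), a * heatKer n (a * σ) * (b t - b (t - σ))| ≤
      C * √(Real.Gamma (5 / 2)) * a ^ (-(1 / 4) : ℝ) * √(pathEnergy b t) := by
  obtain ⟨hI, hle⟩ := integral_sq_exp_mul_heatKer_le h ha
  have hm := (continuous_heatKer n).measurable
  have hΓ := Real.Gamma_pos_of_pos (s := 5 / 2) (by norm_num)
  have hsq : ∀ σ ∈ Ioi (0 : ℝ), (σ ^ (-(3 / 4) : ℝ) * |b t - b (t - σ)|) ^ 2 =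
      σ ^ (-(3 / 2) : ℝ) * (b t - b (t - σ)) ^ 2 := by
    intro σ hσ
    rw [mul_pow, sq_abs, ← Real.rpow_natCast, ← Real.rpow_mul (le_of_lt hσ)]
    norm_num
  have hf : MemLp (fun σ => σ ^ (3 / 4 : ℝ) * |a * heatKer n (a * σ)|) 2
      (volume.restrict (Ioi 0)) :=
    (memLp_two_iff_integrable_sq (Measurable.aestronglyMeasurable (by fun_prop))).2 hI
  have hg : MemLp (fun σ => σ ^ (-(3 / 4) : ℝ) * |b t - b (t - σ)|) 2
      (volume.restrict (Ioi 0)) := by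
    refine (memLp_two_iff_integrable_sq (Measurable.aestronglyMeasurable ?_)).2
      (hE.congr_fun (fun σ hσ => (hsq σ hσ).symm) measurableSet_Ioi)
    have := hb.measurable
    fun_prop
  have key := integral_mul_le_Lp_mul_Lq_of_nonneg (μ := volume.restrict (Ioi (0 : ℝ)))
    Real.HolderConjugate.two_two (f := fun σ => σ ^ (3 / 4 : ℝ) * |a * heatKer n (a * σ)|)
    (g := fun σ => σ ^ (-(3 / 4) : ℝ) * |b t - b (t - σ)|)
    ((ae_restrict_mem measurableSet_Ioi).mono fun σ hσ =>
      mul_nonneg (Real.rpow_nonneg (le_of_lt hσ) _) (abs_nonneg _))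
    ((ae_restrict_mem measurableSet_Ioi).mono fun σ hσ =>
      mul_nonneg (Real.rpow_nonneg (le_of_lt hσ) _) (abs_nonneg _))
    (by simpa using hf) (by simpa using hg)
  simp only [Real.rpow_two, ← Real.sqrt_eq_rpow] at key
  rw [setIntegral_congr_fun measurableSet_Ioi hsq] at key
  calc _ ≤ ∫ σ in Ioi (0 : ℝ), |a * heatKer n (a * σ) * (b t - b (t - σ))| :=
        abs_integral_le_integral_abs
    _ = ∫ σ in Ioi (0 : ℝ), σ ^ (3 / 4 : ℝ) * |a * heatKer n (a * σ)| *
        (σ ^ (-(3 / 4) : ℝ) * |b t - b (t - σ)|) := by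
        refine setIntegral_congr_fun measurableSet_Ioi fun σ hσ => ?_
        have : σ ^ (3 / 4 : ℝ) * σ ^ (-(3 / 4) : ℝ) = 1 := by
          rw [← Real.rpow_add hσ]; norm_num
        simp only [abs_mul]
        linear_combination (-(|a| * |heatKer n (a * σ)| * |b t - b (t - σ)|)) * this
    _ ≤ _ := key
    _ ≤ √(C ^ 2 * Real.Gamma (5 / 2) * a ^ (-(1 / 2) : ℝ)) * √(pathEnergy b t) := by
        rw [pathEnergy]
        gcongr
    _ = _ := by
        rw [Real.sqrt_mul (by positivity), Real.sqrt_mul (by positivity), Real.sqrt_sq hC,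
          Real.sqrt_eq_rpow (a ^ _), ← Real.rpow_mul ha.le]
        norm_num

/-- With x = a t this extracts from the initial-value term the same factor a^{-1/4} as from the
noise term, at the price of t^{-1/4}, which is still square integrable at 0. -/
theorem rpow_quarter_le {x : ℝ} (hx : 0 < x) :
    Real.exp (-(x / 2)) ≤ 2 * x ^ (-(1 / 4) : ℝ) := by
  have h1 : x ^ (1 / 4 : ℝ) ≤ 2 * Real.exp (x / 2) := by
    have h3 := Real.add_one_le_exp (x / 2)
    rcases le_total x 1 with h | h
    · have := Real.rpow_le_one hx.le h (z := 1 / 4) (by norm_num)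
      linarith
    · have := Real.rpow_le_rpow_of_exponent_le h (y := 1 / 4) (z := 1) (by norm_num)
      rw [Real.rpow_one] at this
      linarith
  rw [Real.rpow_neg hx.le, Real.exp_neg, ← div_eq_mul_inv, le_div_iff₀ (by positivity),
    ← div_eq_inv_mul, div_le_iff₀ (Real.exp_pos _)]
  exact h1

theorem exists_abs_modeDeriv_le (n : ℕ) : ∃ C, 0 ≤ C ∧ ∀ (l c : ℝ) (b : ℝ → ℝ), Continuous b →
    ∀ s t, 0 < t →
    IntegrableOn (fun σ => σ ^ (-(3 / 2) : ℝ) * (b t - b (t - σ)) ^ 2) (Ioi 0) →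
    |modeDeriv l c b n s t| ≤ C * (|l| ^ n * Real.exp (-(s * l / 4))) *
      (|c| * t ^ (-(1 / 4) : ℝ) + √(pathEnergy b t)) := by
  obtain ⟨C₁, hC₁, h₁⟩ := exists_abs_heatFn_le n
  obtain ⟨C₂, hC₂, h₂⟩ := exists_abs_heatKer_le n
  have hΓ := Real.Gamma_pos_of_pos (s := 5 / 2) (by norm_num)
  refine ⟨2 * C₁ + C₂ * √(Real.Gamma (5 / 2)), by positivity, fun l c b hb s t ht hE => ?_⟩
  have ha : Real.exp (s * l) ^ (-(1 / 4) : ℝ) = Real.exp (-(s * l / 4)) := by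
    rw [← Real.exp_mul]; congr 1; ring
  have k₂ := abs_integral_heatKer_mul_le hC₂ h₂ (Real.exp_pos (s * l)) hb hE
  have k₁ : |heatFn n (Real.exp (s * l) * t)| ≤
      2 * C₁ * (Real.exp (-(s * l / 4)) * t ^ (-(1 / 4) : ℝ)) := by
    have hat : 0 < Real.exp (s * l) * t := by positivity
    refine (h₁ _ hat.le).trans ?_
    have := mul_le_mul_of_nonneg_left (rpow_quarter_le hat) hC₁
    rw [Real.mul_rpow (Real.exp_pos _).le ht.le, ha] at this
    linarith
  rw [ha] at k₂
  set E := Real.exp (-(s * l / 4))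
  have hE0 : 0 ≤ E := (Real.exp_pos _).le
  have ht0 : 0 ≤ t ^ (-(1 / 4) : ℝ) := by positivity
  rw [modeDeriv, abs_mul, abs_pow]
  have k₃ := (abs_sub (c * heatFn n (Real.exp (s * l) * t)) (∫ σ in Ioi (0 : ℝ),
    Real.exp (s * l) * heatKer n (Real.exp (s * l) * σ) * (b t - b (t - σ))))
  rw [abs_mul] at k₃
  have k₄ := mul_le_mul_of_nonneg_left k₁ (abs_nonneg c)
  have hG : 0 ≤ √(Real.Gamma (5 / 2)) := Real.sqrt_nonneg _
  have hP : 0 ≤ √(pathEnergy b t) := Real.sqrt_nonneg _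
  calc _ ≤ |l| ^ n * (|c| * (2 * C₁ * (E * t ^ (-(1 / 4) : ℝ))) +
        C₂ * √(Real.Gamma (5 / 2)) * E * √(pathEnergy b t)) := by gcongr; linarith
    _ = |l| ^ n * E * (2 * C₁ * (|c| * t ^ (-(1 / 4) : ℝ)) +
        C₂ * √(Real.Gamma (5 / 2)) * √(pathEnergy b t)) := by ring
    _ ≤ |l| ^ n * E * ((2 * C₁ + C₂ * √(Real.Gamma (5 / 2))) * (|c| * t ^ (-(1 / 4) : ℝ)) +
        (2 * C₁ + C₂ * √(Real.Gamma (5 / 2))) * √(pathEnergy b t)) := by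
        gcongr
        · have : 0 ≤ C₂ * √(Real.Gamma (5 / 2)) := by positivity
          linarith
        · linarith
    _ = _ := by ring

/-- For l ≥ 0 the exponential beats the power. Since l = log λ may be negative when λ < 1, the lower
bound l₀ is needed to keep the other case in a compact range. -/
theorem exists_pow_mul_exp_neg_le (n : ℕ) (l₀ : ℝ) {s₀ : ℝ} (hs₀ : 0 < s₀) (s₁ : ℝ) :
    ∃ K, 0 ≤ K ∧ ∀ l, l₀ ≤ l → ∀ s, s₀ ≤ s → s ≤ s₁ → |l| ^ n * Real.exp (-(s * l / 4)) ≤ K := by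
  refine ⟨n.factorial * (4 / s₀) ^ n + |l₀| ^ n * Real.exp (s₁ * |l₀| / 4), by positivity,
    fun l hl s h0 h1 => ?_⟩
  rcases le_total 0 l with h | h
  · refine le_add_of_le_of_nonneg ?_ (by positivity)
    have h2 := Real.pow_div_factorial_le_exp (x := s₀ * l / 4) (by positivity) n
    rw [div_le_iff₀ (by positivity)] at h2
    have h3 : |l| ^ n = (4 / s₀) ^ n * (s₀ * l / 4) ^ n := by
      rw [← mul_pow, abs_of_nonneg h]; congr 1; field_simp
    calc |l| ^ n * Real.exp (-(s * l / 4))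
        ≤ (4 / s₀) ^ n * (Real.exp (s₀ * l / 4) * n.factorial) *
          Real.exp (-(s₀ * l / 4)) := by rw [h3]; gcongr
      _ = n.factorial * (4 / s₀) ^ n * (Real.exp (s₀ * l / 4) * Real.exp (-(s₀ * l / 4))) := by
          ring
      _ = _ := by rw [← Real.exp_add]; simp
  · refine le_add_of_nonneg_of_le (by positivity) ?_
    have h2 : |l| ≤ |l₀| := by rw [abs_of_nonpos h, abs_of_nonpos (hl.trans h)]; linarith
    have h3 : s * |l| ≤ s₁ * |l₀| := mul_le_mul h1 h2 (abs_nonneg l) (by linarith)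
    have h4 : -(s * l / 4) ≤ s₁ * |l₀| / 4 := by rw [abs_of_nonpos h] at h3; linarith
    gcongr

/-! ### Variation of constants, path by path -/

/-- Variation of constants for `y(t) = c - ∫₀ᵗ a y + b(t)`. -/
noncomputable def duhamel (a c : ℝ) (b : ℝ → ℝ) (t : ℝ) : ℝ :=
  Real.exp (-(a * t)) * (c - a * ∫ τ in (0 : ℝ)..t, Real.exp (a * τ) * b τ) + b t

/-- The path b is merely continuous, so only the solution minus b is differentiable; the formula,
already integrated by parts, involves no integral against db. -/
theorem hasDerivAt_duhamel_sub (a c : ℝ) {b : ℝ → ℝ} (hb : Continuous b) (t : ℝ) :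
    HasDerivAt (fun t => duhamel a c b t - b t) (-(a * duhamel a c b t)) t := by
  have h1 : HasDerivAt (fun t => ∫ τ in (0 : ℝ)..t, Real.exp (a * τ) * b τ)
      (Real.exp (a * t) * b t) t :=
    (Continuous.integral_hasStrictDerivAt (by fun_prop) 0 t).hasDerivAt
  have h2 : HasDerivAt (fun t => Real.exp (-(a * t))) (Real.exp (-(a * t)) * (-(a * 1))) t :=
    ((hasDerivAt_id t).const_mul a).neg.exp
  have h3 := h2.mul ((h1.const_mul a).const_sub c)
  have h4 : Real.exp (-(a * t)) * Real.exp (a * t) = 1 := by rw [← Real.exp_add]; simp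
  refine (h3.congr_deriv ?_).congr_of_eventuallyEq (Eventually.of_forall fun r => ?_)
  · unfold duhamel
    linear_combination (-(a * b t)) * h4
  · simp [duhamel]

theorem continuous_duhamel (a c : ℝ) {b : ℝ → ℝ} (hb : Continuous b) :
    Continuous (duhamel a c b) := by
  have h : Continuous fun t => duhamel a c b t - b t :=
    continuous_iff_continuousAt.2 fun t => (hasDerivAt_duhamel_sub a c hb t).continuousAt
  exact (h.add hb).congr fun t => sub_add_cancel _ _

theorem duhamel_eq (a c : ℝ) {b : ℝ → ℝ} (hb : Continuous b) (t : ℝ) :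
    duhamel a c b t = c - (∫ τ in (0 : ℝ)..t, a * duhamel a c b τ) + b t := by
  have h := intervalIntegral.integral_eq_sub_of_hasDerivAt
    (fun τ _ => hasDerivAt_duhamel_sub a c hb τ)
    (Continuous.intervalIntegrable (μ := volume)
      ((continuous_const.mul (continuous_duhamel a c hb)).neg) 0 t)
  rw [intervalIntegral.integral_neg] at h
  have h0 : duhamel a c b 0 - b 0 = c := by simp [duhamel]
  linarith

theorem eq_duhamel {a c T : ℝ} {b y : ℝ → ℝ} (hb : Continuous b) (hy : ContinuousOn y (Icc 0 T))
    (h : ∀ t ∈ Icc 0 T, y t = c - (∫ τ in (0 : ℝ)..t, a * y τ) + b t) {t : ℝ}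
    (ht : t ∈ Icc 0 T) : y t = duhamel a c b t := by
  have hT : 0 ≤ T := ht.1.trans ht.2
  -- Freezing y outside [0,T] makes it continuous on the line, so that its primitive has two-sided
  -- derivatives up to the endpoints.
  set z : ℝ → ℝ := fun r => y (max 0 (min r T)) with hz
  have hzc : Continuous z := hy.comp_continuous (by fun_prop) fun r =>
    ⟨le_max_left _ _, max_le hT (min_le_right _ _)⟩
  have hzy : ∀ r ∈ Icc 0 T, z r = y r := fun r hr => by
    simp only [hz, min_eq_left hr.2, max_eq_right hr.1]
  have hint : ∀ r ∈ Icc 0 T, ∫ τ in (0 : ℝ)..r, a * y τ = ∫ τ in (0 : ℝ)..r, a * z τ :=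
    fun r hr => intervalIntegral.integral_congr fun τ hτ => by
      rw [uIcc_of_le hr.1] at hτ
      simp only [hzy τ ⟨hτ.1, hτ.2.trans hr.2⟩]
  -- The difference of the two solutions times the integrating factor e^{ar}: its derivative
  -- vanishes, and v(0) = 0.
  set v : ℝ → ℝ := fun r => Real.exp (a * r) *
    (c - (∫ τ in (0 : ℝ)..r, a * z τ) - (duhamel a c b r - b r)) with hv
  have hvd : ∀ r ∈ Icc 0 T, HasDerivAt v 0 r := fun r hr => by
    have h1 : HasDerivAt (fun r => ∫ τ in (0 : ℝ)..r, a * z τ) (a * z r) r :=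
      (Continuous.integral_hasStrictDerivAt (by fun_prop) 0 r).hasDerivAt
    have h2 : HasDerivAt (fun r => Real.exp (a * r)) (Real.exp (a * r) * (a * 1)) r :=
      ((hasDerivAt_id r).const_mul a).exp
    refine (h2.mul ((h1.const_sub c).sub (hasDerivAt_duhamel_sub a c hb r))).congr_deriv ?_
    have h3 := h r hr
    rw [hint r hr, ← hzy r hr] at h3
    simp only [Pi.sub_apply]
    linear_combination (-(a * Real.exp (a * r))) * h3
  have hc := constant_of_has_deriv_right_zero (f := v) (a := 0) (b := T)
    (fun r hr => (hvd r hr).continuousAt.continuousWithinAt)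
    (fun r hr => (hvd r (Ico_subset_Icc_self hr)).hasDerivWithinAt) t ht
  have hv0 : v 0 = 0 := by simp [hv, duhamel]
  rw [hv0, hv] at hc
  have h5 := (mul_eq_zero.1 hc).resolve_left (Real.exp_ne_zero _)
  rw [h t ht, hint t ht]
  linarith

theorem duhamel_eq_modeDeriv (l c : ℝ) {b : ℝ → ℝ} (hb : Continuous b) {M : ℝ}
    (hM : ∀ t, |b t| ≤ M) (hb0 : ∀ t ≤ 0, b t = 0) (s : ℝ) {t : ℝ} (ht : 0 ≤ t) :
    duhamel (Real.exp (s * l)) c b t = modeDeriv l c b 0 s t := by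
  set a := Real.exp (s * l) with ha
  have ha0 : 0 < a := Real.exp_pos _
  have hexp : IntegrableOn (fun σ => Real.exp (-(a * σ))) (Ioi 0) := by
    simpa using integrableOn_exp_mul_Ioi (neg_lt_zero.2 ha0) 0
  have hexp' : IntegrableOn (fun σ => Real.exp (-(a * σ)) * b (t - σ)) (Ioi 0) := by
    refine (hexp.mul_const M).mono' (Continuous.aestronglyMeasurable (by fun_prop))
      (Eventually.of_forall fun σ => ?_)
    rw [norm_mul, Real.norm_eq_abs, Real.abs_exp]
    exact mul_le_mul_of_nonneg_left (hM _) (Real.exp_pos _).le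
  have h1 : ∫ σ in Ioi (0 : ℝ), a * Real.exp (-(a * σ)) = 1 := by
    have := integral_exp_mul_Ioi (neg_lt_zero.2 ha0) 0
    simp only [neg_mul, mul_zero, Real.exp_zero] at this
    rw [integral_const_mul, this]
    field_simp
  have h2 : ∫ σ in Ioi (0 : ℝ), Real.exp (-(a * σ)) * b (t - σ) =
      Real.exp (-(a * t)) * ∫ τ in (0 : ℝ)..t, Real.exp (a * τ) * b τ := by
    rw [← intervalIntegral.integral_const_mul]
    have h3 := intervalIntegral.integral_comp_sub_left
      (fun τ => Real.exp (-(a * t)) * (Real.exp (a * τ) * b τ)) t (a := 0) (b := t)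
    rw [sub_self, sub_zero] at h3
    rw [← h3, intervalIntegral.integral_of_le ht]
    -- Lags σ > t contribute nothing, since b vanishes at nonpositive times.
    refine (setIntegral_eq_of_subset_of_forall_sdiff_eq_zero measurableSet_Ioi
      Ioc_subset_Ioi_self fun σ hσ => ?_).trans
      (setIntegral_congr_fun measurableSet_Ioc fun σ _ => ?_)
    · have : t - σ ≤ 0 := by
        by_contra hcon
        exact hσ.2 ⟨hσ.1, by linarith⟩
      simp [hb0 _ this]
    · rw [← mul_assoc, ← Real.exp_add]
      congr 2
      ring
  have h4 : ∫ σ in Ioi (0 : ℝ), a * heatKer 0 (a * σ) * (b t - b (t - σ)) =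
      -b t + a * ∫ σ in Ioi (0 : ℝ), Real.exp (-(a * σ)) * b (t - σ) := by
    have e : ∀ σ, a * heatKer 0 (a * σ) * (b t - b (t - σ)) =
        -(b t) * (a * Real.exp (-(a * σ))) + a * (Real.exp (-(a * σ)) * b (t - σ)) :=
      fun σ => by rw [heatKer_zero]; ring
    simp only [e]
    rw [integral_add ((hexp.const_mul a).const_mul _) (hexp'.const_mul a), integral_const_mul (-(b t)),
      integral_const_mul a (fun σ => Real.exp (-(a * σ)) * b (t - σ)), h1, mul_one]
  rw [modeDeriv, ← ha, h4, h2, heatFn_zero, duhamel]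
  ring

/-! ### Orthogonal copies of L²(ν) inside L²(m × ν) -/

section Tensor

variable {α β : Type*} [MeasurableSpace α] [MeasurableSpace β] {ν : Measure α} {m : Measure β}

theorem memLp_two_mul_prod {f : α → ℝ} {g : β → ℝ} (hf : MemLp f 2 ν) (hg : MemLp g 2 m) :
    MemLp (fun p : β × α => f p.2 * g p.1) 2 (m.prod ν) := by
  have hm : AEStronglyMeasurable (fun p : β × α => f p.2 * g p.1) (m.prod ν) :=
    hf.1.comp_snd.mul hg.1.comp_fst
  rw [memLp_two_iff_integrable_sq hm]
  refine (hg.integrable_sq.mul_prod hf.integrable_sq).congr (Eventually.of_forall fun p => ?_)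
  simp only
  ring

variable [SFinite ν] [SFinite m]

theorem inner_toLp_mul_prod (f f' : Lp ℝ 2 ν) (g g' : Lp ℝ 2 m) :
    ⟪(memLp_two_mul_prod (Lp.memLp f) (Lp.memLp g)).toLp,
      (memLp_two_mul_prod (Lp.memLp f') (Lp.memLp g')).toLp⟫ = ⟪g, g'⟫ * ⟪f, f'⟫ := by
  rw [L2.inner_def, L2.inner_def, L2.inner_def, ← integral_prod_mul]
  refine integral_congr_ae ?_
  filter_upwards [(memLp_two_mul_prod (Lp.memLp f) (Lp.memLp g)).coeFn_toLp,
    (memLp_two_mul_prod (Lp.memLp f') (Lp.memLp g')).coeFn_toLp] with p h h'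
  rw [h, h']
  simp only [RCLike.inner_apply, conj_trivial]
  ring

/-- The isometric embedding `f ↦ f ⊗ g` of `L²(ν)` into `L²(m × ν)` for a unit vector `g`. -/
noncomputable def tensorUnit (g : Lp ℝ 2 m) (hg : ‖g‖ = 1) : Lp ℝ 2 ν →ₗᵢ[ℝ] Lp ℝ 2 (m.prod ν) :=
  LinearMap.isometryOfInner
    { toFun := fun f => (memLp_two_mul_prod (Lp.memLp f) (Lp.memLp g)).toLp
      map_add' := fun f f' => by
        rw [← MemLp.toLp_add]
        refine (MemLp.toLp_eq_toLp_iff _ _).2 ?_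
        filter_upwards [Measure.quasiMeasurePreserving_snd.ae (Lp.coeFn_add f f')] with p hp
        simp only [hp, Pi.add_apply, add_mul]
      map_smul' := fun c f => by
        rw [RingHom.id_apply, ← MemLp.toLp_const_smul]
        refine (MemLp.toLp_eq_toLp_iff _ _).2 ?_
        filter_upwards [Measure.quasiMeasurePreserving_snd.ae (Lp.coeFn_smul c f)] with p hp
        simp only [hp, Pi.smul_apply, smul_eq_mul, mul_assoc] }
    fun f f' => by
      refine (inner_toLp_mul_prod f f' g g).trans ?_
      rw [real_inner_self_eq_norm_sq, hg]
      ring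

theorem tensorUnit_toLp {g : Lp ℝ 2 m} (hg : ‖g‖ = 1) {f : α → ℝ} (hf : MemLp f 2 ν) :
    tensorUnit g hg hf.toLp = (memLp_two_mul_prod hf (Lp.memLp g)).toLp := by
  refine (MemLp.toLp_eq_toLp_iff (memLp_two_mul_prod (Lp.memLp hf.toLp) (Lp.memLp g)) _).2 ?_
  filter_upwards [Measure.quasiMeasurePreserving_snd.ae hf.coeFn_toLp] with p hp
  rw [hp]

theorem orthogonalFamily_tensorUnit {e : ℕ → Lp ℝ 2 m} (he : Orthonormal ℝ e) :
    OrthogonalFamily ℝ (fun _ : ℕ => Lp ℝ 2 ν) fun j => tensorUnit (e j) (he.1 j) := by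
  intro i j hij f f'
  refine (inner_toLp_mul_prod f f' (e i) (e j)).trans ?_
  rw [he.2 hij, zero_mul]

end Tensor

/-! ### Termwise differentiation of orthogonal series -/

theorem abs_taylor_two_le {u u' u'' : ℝ → ℝ} {C s r : ℝ}
    (hu : ∀ x ∈ uIcc s r, HasDerivAt u (u' x) x) (hu' : ∀ x ∈ uIcc s r, HasDerivAt u' (u'' x) x)
    (hC : ∀ x ∈ uIcc s r, |u'' x| ≤ C) : |u r - u s - (r - s) * u' s| ≤ C * (r - s) ^ 2 := by
  have hC0 : 0 ≤ C := (abs_nonneg _).trans (hC s left_mem_uIcc)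
  have h1 : ∀ x ∈ uIcc s r, |u' x - u' s| ≤ C * |r - s| := fun x hx =>
    (Convex.norm_image_sub_le_of_norm_hasDerivWithin_le
      (fun y hy => (hu' y hy).hasDerivWithinAt) hC (convex_uIcc s r) left_mem_uIcc hx).trans
      (mul_le_mul_of_nonneg_left (abs_sub_left_of_mem_uIcc hx) hC0)
  have h2 := Convex.norm_image_sub_le_of_norm_hasDerivWithin_le (f := fun x => u x - x * u' s)
    (f' := fun x => u' x - u' s) (s := uIcc s r)
    (fun x hx => by
      refine (((hu x hx).sub
        ((hasDerivAt_id x).mul_const (u' s))).congr_deriv ?_).hasDerivWithinAt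
      rw [one_mul])
    h1 (convex_uIcc s r) left_mem_uIcc right_mem_uIcc
  rw [Real.norm_eq_abs, Real.norm_eq_abs, mul_assoc, ← sq, sq_abs] at h2
  refine le_trans (le_of_eq ?_) h2
  congr 1
  ring

/-- Quadratic Taylor remainders dominated componentwise by one ℓ² sequence add up to a quadratic
remainder in ℓ². -/
theorem hasDerivAt_lp_of_norm_taylor_le {G : Type*} [NormedAddCommGroup G] [NormedSpace ℝ G]
    {X : ℝ → lp (fun _ : ℕ => G) 2} {X' : lp (fun _ : ℕ => G) 2} {s : ℝ}
    (N : lp (fun _ : ℕ => ℝ) 2) {K : ℝ}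
    (h : ∀ᶠ r in 𝓝 s, ∀ j, ‖X r j - X s j - (r - s) • X' j‖ ≤ K * (r - s) ^ 2 * ‖N j‖) :
    HasDerivAt X X' s := by
  rw [hasDerivAt_iff_isLittleO]
  have h1 : (fun r => X r - X s - (r - s) • X') =O[𝓝 s] fun r => (r - s) ^ 2 := by
    refine Asymptotics.IsBigO.of_bound (|K| * ‖N‖) (h.mono fun r hr => ?_)
    have h2 : ‖X r - X s - (r - s) • X'‖ ≤ ‖(|K| * (r - s) ^ 2) • N‖ := by
      refine lp.norm_mono (by norm_num) fun j => (hr j).trans ?_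
      rw [lp.coeFn_smul, Pi.smul_apply, norm_smul, norm_mul, Real.norm_of_nonneg (sq_nonneg (r - s)),
        Real.norm_eq_abs |K|, abs_abs]
      gcongr
      exact le_abs_self K
    refine h2.trans (le_of_eq ?_)
    rw [norm_smul, norm_mul, Real.norm_eq_abs |K|, abs_abs]
    ring
  refine h1.trans_isLittleO ?_
  have h3 : (fun x : ℝ => x ^ 2) =o[𝓝 0] fun x => x := by
    simpa using Asymptotics.isLittleO_pow_pow (𝕜 := ℝ) (m := 1) (n := 2) (by norm_num)
  refine h3.comp_tendsto ?_
  have : Tendsto (fun r => r - s) (𝓝 s) (𝓝 (s - s)) := tendsto_id.sub_const s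
  simpa using this

theorem exists_hasDerivAt_orthogonal_series {α β : Type*} [MeasurableSpace α] [MeasurableSpace β]
    {ν : Measure α} {m : Measure β} [SFinite ν] [SFinite m] {e : ℕ → Lp ℝ 2 m}
    (he : Orthonormal ℝ e) (U : ℕ → ℕ → ℝ → α → ℝ) (g : ℕ → α → ℝ)
    (hUm : ∀ n j s, AEStronglyMeasurable (U n j s) ν)
    (hU : ∀ n j s t, HasDerivAt (fun r => U n j r t) (U (n + 1) j s t) s)
    (hg : ∀ j, MemLp (g j) 2 ν) (hgs : Summable fun j => ∫ t, g j t ^ 2 ∂ν)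
    (hb : ∀ n s₀ s₁, 0 < s₀ → ∃ K, 0 ≤ K ∧ ∀ j, ∀ᵐ t ∂ν, ∀ s ∈ Icc s₀ s₁, |U n j s t| ≤ K * g j t) :
    ∃ S : ℕ → ℝ → Lp ℝ 2 (m.prod ν), ∀ n s, 0 < s →
      (∃ h : ∀ j, MemLp (fun p : β × α => U n j s p.2 * e j p.1) 2 (m.prod ν),
        HasSum (fun j => (h j).toLp) (S n s)) ∧ HasDerivAt (S n) (S (n + 1) s) s := by
  have hmem : ∀ n s, 0 < s → ∀ j, MemLp (U n j s) 2 ν := fun n s hs j => by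
    obtain ⟨K, -, hK⟩ := hb n s s hs
    exact ((hg j).const_mul K).mono' (hUm n j s)
      ((hK j).mono fun t ht => ht s (left_mem_Icc.2 le_rfl))
  have hgn : ∀ j, ‖(hg j).toLp‖ ^ 2 = ∫ t, g j t ^ 2 ∂ν := fun j => by
    rw [← real_inner_self_eq_norm_sq, L2.inner_def]
    refine integral_congr_ae ((hg j).coeFn_toLp.mono fun t ht => ?_)
    simp only [ht, RCLike.inner_apply, conj_trivial, sq]
  have hN : Memℓp (fun j => ‖(hg j).toLp‖) 2 := by
    refine memℓp_gen ?_
    refine hgs.congr fun j => ?_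
    rw [norm_norm, ← hgn]
    norm_num
  have hmemℓ : ∀ n s (hs : 0 < s), Memℓp (fun j => (hmem n s hs j).toLp) 2 := fun n s hs => by
    obtain ⟨K, hK0, hK⟩ := hb n s s hs
    refine Memℓp.mono' (hN.const_smul K) fun j => ?_
    rw [Pi.smul_apply, norm_smul, norm_norm, Real.norm_of_nonneg hK0]
    refine Lp.norm_le_mul_norm_of_ae_le_mul ?_
    filter_upwards [hK j, (hg j).coeFn_toLp, (hmem n s hs j).coeFn_toLp] with t h1 h2 h3
    rw [h2, h3]
    refine (h1 s (left_mem_Icc.2 le_rfl)).trans (mul_le_mul_of_nonneg_left (le_abs_self _) hK0)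
  classical
  -- The value 0 for s ≤ 0 is arbitrary; only neighbourhoods inside (0,∞) matter.
  let X : ℕ → ℝ → lp (fun _ : ℕ => Lp ℝ 2 ν) 2 := fun n s =>
    if hs : 0 < s then ⟨fun j => (hmem n s hs j).toLp, hmemℓ n s hs⟩ else 0
  have hX : ∀ n s (hs : 0 < s) j, X n s j = (hmem n s hs j).toLp := fun n s hs j => by
    simp only [X, dif_pos hs]
  have hV := orthogonalFamily_tensorUnit (ν := ν) he
  refine ⟨fun n s => hV.linearIsometry (X n s), fun n s hs =>
    ⟨⟨fun j => memLp_two_mul_prod (hmem n s hs j) (Lp.memLp _), ?_⟩, ?_⟩⟩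
  · refine (hV.hasSum_linearIsometry (X n s)).congr_fun fun j => ?_
    rw [hX n s hs, tensorUnit_toLp]
  · refine hV.linearIsometry.toContinuousLinearMap.hasFDerivAt.comp_hasDerivAt s ?_
    -- The Taylor remainder of the n-th derivative is controlled by derivative n + 2 on a compact
    -- neighbourhood of s.
    obtain ⟨K, hK0, hK⟩ := hb (n + 2) (s / 2) (2 * s) (by positivity)
    refine hasDerivAt_lp_of_norm_taylor_le ⟨_, hN⟩ (K := K) ?_
    filter_upwards [Icc_mem_nhds (show s / 2 < s by linarith) (show s < 2 * s by linarith)]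
      with r hr j
    have hr0 : 0 < r := by linarith [hr.1]
    have hsub : uIcc s r ⊆ Icc (s / 2) (2 * s) :=
      uIcc_subset_Icc ⟨by linarith, by linarith⟩ hr
    rw [norm_norm, hX n r hr0, hX n s hs, hX (n + 1) s hs, ← MemLp.toLp_const_smul,
      ← MemLp.toLp_sub, ← MemLp.toLp_sub]
    refine Lp.norm_le_mul_norm_of_ae_le_mul ?_
    filter_upwards [hK j, (hg j).coeFn_toLp, MemLp.coeFn_toLp (((hmem n r hr0 j).sub
      (hmem n s hs j)).sub ((hmem (n + 1) s hs j).const_smul (r - s)))] with t h1 h2 h3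
    rw [h2, h3]
    simp only [Pi.sub_apply, Pi.smul_apply, smul_eq_mul, Real.norm_eq_abs]
    refine (abs_taylor_two_le (u := fun x => U n j x t) (u' := fun x => U (n + 1) j x t)
      (u'' := fun x => U (n + 2) j x t) (fun x _ => hU n j x t) (fun x _ => hU (n + 1) j x t)
      fun x hx => h1 x (hsub hx)).trans ?_
    calc K * g j t * (r - s) ^ 2 ≤ K * |g j t| * (r - s) ^ 2 := by gcongr; exact le_abs_self _
      _ = _ := by ring

/-! ### Almost sure summability of the noise energies -/

theorem lintegral_sq_gaussianReal (v : NNReal) :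
    ∫⁻ x, ENNReal.ofReal (x ^ 2) ∂gaussianReal 0 v = v := by
  have h : MemLp (fun x : ℝ => x) 2 (gaussianReal 0 v) := memLp_id_gaussianReal 2
  rw [← ofReal_integral_eq_lintegral_ofReal h.integrable_sq
    (Eventually.of_forall fun x => sq_nonneg x)]
  have h1 := variance_fun_id_gaussianReal (μ := 0) (v := v)
  rw [variance_of_integral_eq_zero measurable_id'.aemeasurable (by simp)] at h1
  rw [h1, ENNReal.ofReal_coe_nnreal]

theorem integrableOn_rpow_mul_min {T : ℝ} (hT : 0 < T) :
    IntegrableOn (fun σ : ℝ => σ ^ (-(3 / 2) : ℝ) * min σ T) (Ioi 0) := by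
  have hm : ∀ s : Set ℝ, AEStronglyMeasurable (fun σ : ℝ => σ ^ (-(3 / 2) : ℝ) * min σ T)
      (volume.restrict s) := fun s => Measurable.aestronglyMeasurable (by fun_prop)
  rw [← Ioc_union_Ioi_eq_Ioi hT.le]
  refine IntegrableOn.union ?_ ?_
  · have h : IntegrableOn (fun σ : ℝ => σ ^ (-(1 / 2) : ℝ)) (Ioc 0 T) := by
      rw [← intervalIntegrable_iff_integrableOn_Ioc_of_le hT.le]
      exact intervalIntegral.intervalIntegrable_rpow' (by norm_num)
    refine Integrable.mono' h (hm _) ((ae_restrict_mem measurableSet_Ioc).mono fun σ hσ => ?_)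
    have h0 : 0 < σ := hσ.1
    rw [min_eq_left hσ.2, Real.norm_of_nonneg (by positivity), ← Real.rpow_add_one h0.ne']
    norm_num
  · refine Integrable.mono' ((integrableOn_Ioi_rpow_of_lt (a := -(3 / 2)) (by norm_num)
      hT).mul_const T) (hm _) ((ae_restrict_mem measurableSet_Ioi).mono fun σ hσ => ?_)
    have h0 : 0 < σ := hT.trans hσ
    rw [min_eq_right (le_of_lt hσ), Real.norm_of_nonneg (by positivity)]

section Noise

variable {H : Type*} [NormedAddCommGroup H] [InnerProductSpace ℝ H]
  {Ω : Type*} {mΩ : MeasurableSpace Ω}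

/-- The path `t ↦ √μ_j B_j(t)`, extended to the real line by its values at `0` and `T`. -/
noncomputable def noisePath (e : HilbertBasis ℕ ℝ H) (μ : ℕ → ℝ) (T : ℝ) (W : ℝ → Ω → H) (j : ℕ)
    (ω : Ω) (t : ℝ) : ℝ :=
  √(μ j) * coordinateBM e μ W j (max 0 (min t T)) ω

/-- The event that the path of `W` starts at `0` and is continuous on `[0,T]`. -/
def IsGoodPath (T : ℝ) (W : ℝ → Ω → H) (ω : Ω) : Prop :=
  W 0 ω = 0 ∧ ContinuousOn (fun t => W t ω) (Icc 0 T)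

variable {e : HilbertBasis ℕ ℝ H} {μ : ℕ → ℝ} {T : ℝ} {W : ℝ → Ω → H}

theorem clamp_mem_Icc (hT : 0 ≤ T) (t : ℝ) : max 0 (min t T) ∈ Icc 0 T :=
  ⟨le_max_left _ _, max_le hT (min_le_right _ _)⟩

theorem clamp_eq_self {t : ℝ} (ht : t ∈ Icc 0 T) : max 0 (min t T) = t := by
  rw [min_eq_left ht.2, max_eq_right ht.1]

theorem noisePath_of_mem_Icc (j : ℕ) (ω : Ω) {t : ℝ} (ht : t ∈ Icc 0 T) :
    noisePath e μ T W j ω t = √(μ j) * coordinateBM e μ W j t ω := by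
  rw [noisePath, clamp_eq_self ht]

theorem IsGoodPath.continuous_noisePath (hT : 0 ≤ T) {ω : Ω} (hω : IsGoodPath T W ω) (j : ℕ) :
    Continuous (noisePath e μ T W j ω) := by
  have h : Continuous fun t => W (max 0 (min t T)) ω :=
    hω.2.comp_continuous (by fun_prop) (clamp_mem_Icc hT)
  unfold noisePath coordinateBM
  exact continuous_const.mul ((continuous_const.inner h).div_const _)

theorem IsGoodPath.noisePath_of_nonpos (hT : 0 ≤ T) {ω : Ω} (hω : IsGoodPath T W ω) (j : ℕ)
    {t : ℝ} (ht : t ≤ 0) : noisePath e μ T W j ω t = 0 := by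
  rw [noisePath, coordinateBM, min_eq_left (ht.trans hT), max_eq_left ht, hω.1]
  simp

theorem IsGoodPath.exists_abs_noisePath_le (hT : 0 ≤ T) {ω : Ω} (hω : IsGoodPath T W ω) (j : ℕ) :
    ∃ M, ∀ t, |noisePath e μ T W j ω t| ≤ M := by
  obtain ⟨M, hM⟩ := isCompact_Icc.exists_bound_of_continuousOn
    (hω.continuous_noisePath (e := e) (μ := μ) hT j).continuousOn (s := Icc 0 T)
  refine ⟨M, fun t => ?_⟩
  have := hM _ (clamp_mem_Icc hT t)
  rwa [noisePath_of_mem_Icc j ω (clamp_mem_Icc hT t), Real.norm_eq_abs] at this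

/-- Equality can fail when √μ_j = 0: the left side is then 0, whereas ⟨W, e_j⟩ need not vanish at
every ω. -/
theorem abs_noisePath_sub_le (j : ℕ) (ω : Ω) (t r : ℝ) :
    |noisePath e μ T W j ω t - noisePath e μ T W j ω r| ≤
      |⟪W (max 0 (min t T)) ω - W (max 0 (min r T)) ω, e j⟫| := by
  unfold noisePath coordinateBM
  rcases eq_or_ne (√(μ j)) 0 with h | h
  · simp [h]
  · rw [mul_div_cancel₀ _ h, mul_div_cancel₀ _ h, ← inner_sub_right, real_inner_comm]

variable {ℱ : Filtration ℝ mΩ} {P : Measure Ω} {Q : H →L[ℝ] H}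

theorem IsQWienerProcess.ae_isGoodPath (hW : IsQWienerProcess Q T ℱ P W) :
    ∀ᵐ ω ∂P, IsGoodPath T W ω := hW.initial.and hW.continuous_paths

theorem IsQWienerProcess.exists_measurableSet_isGoodPath (hW : IsQWienerProcess Q T ℱ P W) :
    ∃ G : Set Ω, MeasurableSet G ∧ P Gᶜ = 0 ∧ ∀ ω ∈ G, IsGoodPath T W ω := by
  obtain ⟨N, hN, hNm, hN0⟩ := exists_measurable_superset_of_null (ae_iff.1 hW.ae_isGoodPath)
  refine ⟨Nᶜ, hNm.compl, by rwa [compl_compl], fun ω hω => ?_⟩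
  by_contra h
  exact hω (hN h)

theorem IsQWienerProcess.stronglyMeasurable_noisePath (hW : IsQWienerProcess Q T ℱ P W)
    (hT : 0 ≤ T) (j : ℕ) (t : ℝ) :
    StronglyMeasurable[ℱ (max 0 (min t T))] fun ω => noisePath e μ T W j ω t := by
  have h := hW.adapted _ (clamp_mem_Icc hT t)
  have h2 : StronglyMeasurable[ℱ (max 0 (min t T))] fun ω => ⟪e j, W (max 0 (min t T)) ω⟫ :=
    (continuous_const.inner continuous_id).comp_stronglyMeasurable h
  exact Continuous.comp_stronglyMeasurable (g := fun x : ℝ => √(μ j) * (x / √(μ j)))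
    (by fun_prop) h2

theorem IsQWienerProcess.lintegral_sq_inner_sub (hW : IsQWienerProcess Q T ℱ P W)
    {r t : ℝ} (hr : 0 ≤ r) (hrt : r ≤ t) (ht : t ≤ T) (v : H) :
    ∫⁻ ω, ENNReal.ofReal (⟪W t ω - W r ω, v⟫ ^ 2) ∂P =
      ENNReal.ofReal ((t - r) * ⟪Q v, v⟫) := by
  rcases hrt.eq_or_lt with rfl | h
  · simp
  have hm : ∀ s ∈ Icc 0 T, StronglyMeasurable (W s) := fun s hs => (hW.adapted s hs).mono (ℱ.le s)
  have hmeas : Measurable fun ω => ⟪W t ω - W r ω, v⟫ :=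
    (Continuous.comp_stronglyMeasurable (g := fun x : H => ⟪x, v⟫) (by fun_prop)
      ((hm t ⟨hr.trans hrt, ht⟩).sub (hm r ⟨hr, hrt.trans ht⟩))).measurable
  rw [← lintegral_map (f := fun x : ℝ => ENNReal.ofReal (x ^ 2)) (by fun_prop) hmeas,
    hW.gaussian_increments r t hr h ht v, lintegral_sq_gaussianReal]
  rfl

/-- Clamping to [0,T] is 1-Lipschitz with range of length T, so the clamped times differ by at most
min(σ, T). -/
theorem IsQWienerProcess.lintegral_sq_noisePath_sub_le (hW : IsQWienerProcess Q T ℱ P W)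
    (hT : 0 ≤ T) {j : ℕ} (hQ : Q (e j) = μ j • e j) (hμ : 0 ≤ μ j) (t : ℝ) {σ : ℝ} (hσ : 0 ≤ σ) :
    ∫⁻ ω, ENNReal.ofReal ((noisePath e μ T W j ω t - noisePath e μ T W j ω (t - σ)) ^ 2) ∂P ≤
      ENNReal.ofReal (min σ T * μ j) := by
  have hle : max 0 (min (t - σ) T) ≤ max 0 (min t T) := by
    gcongr; linarith
  have h := hW.lintegral_sq_inner_sub (clamp_mem_Icc hT (t - σ)).1 hle (clamp_mem_Icc hT t).2 (e j)
  have hn : ⟪Q (e j), e j⟫ = μ j := by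
    rw [hQ, real_inner_smul_left, real_inner_self_eq_norm_sq, e.orthonormal.1 j]; ring
  rw [hn] at h
  refine (lintegral_mono fun ω => ENNReal.ofReal_le_ofReal
    (sq_le_sq.2 (abs_noisePath_sub_le j ω t (t - σ)))).trans (h.le.trans ?_)
  refine ENNReal.ofReal_le_ofReal (mul_le_mul_of_nonneg_right ?_ hμ)
  have h1 := (clamp_mem_Icc hT t).2
  have h2 := (clamp_mem_Icc hT (t - σ)).1
  refine le_min ?_ (by linarith)
  rw [sub_le_iff_le_add]
  refine max_le (by linarith) ?_
  have : min t T ≤ min (t - σ) T + σ := by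
    rw [min_add, sub_add_cancel]
    exact min_le_min le_rfl (by linarith)
  linarith [le_max_right 0 (min (t - σ) T)]

/-- By Tonelli, the expectation of the sum is at most T · ∑ μ_j · ∫₀^∞ σ^{-3/2} min(σ, T) dσ, which
is finite. -/
theorem IsQWienerProcess.ae_tsum_lintegral_energy_ne_top (hW : IsQWienerProcess Q T ℱ P W)
    (hT : 0 < T) (hQ : ∀ j, Q (e j) = μ j • e j) (hμ : ∀ j, 0 ≤ μ j) (hμs : Summable μ)
    [SFinite P] :
    ∀ᵐ ω ∂P, ∑' j, ∫⁻ t in Icc 0 T, ∫⁻ σ in Ioi (0 : ℝ), ENNReal.ofReal (σ ^ (-(3 / 2) : ℝ) *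
      (noisePath e μ T W j ω t - noisePath e μ T W j ω (t - σ)) ^ 2) ≠ ⊤ := by
  classical
  obtain ⟨G, hGm, hG0, hG⟩ := hW.exists_measurableSet_isGoodPath
  -- Setting the bad paths to 0 makes every path continuous, whence joint measurability in (t, ω).
  let B : ℕ → ℝ → Ω → ℝ := fun j t => G.indicator fun ω => noisePath e μ T W j ω t
  have hBm : ∀ j, Measurable (Function.uncurry (B j)) := fun j => by
    refine (stronglyMeasurable_uncurry_of_continuous_of_stronglyMeasurable (fun ω => ?_)
      fun t => ?_).measurable
    · by_cases hω : ω ∈ G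
      · simpa only [B, indicator_of_mem hω] using (hG ω hω).continuous_noisePath hT.le j
      · simpa only [B, indicator_of_notMem hω] using continuous_const
    · exact ((hW.stronglyMeasurable_noisePath hT.le j t).mono (ℱ.le _)).indicator hGm
  let F : ℕ → Ω → ℝ × ℝ → ENNReal := fun j ω p => ENNReal.ofReal (p.2 ^ (-(3 / 2) : ℝ)) *
    ENNReal.ofReal ((B j p.1 ω - B j (p.1 - p.2) ω) ^ 2)
  have hFm : ∀ j, Measurable (Function.uncurry (F j)) := fun j => by
    have h1 : Measurable fun q : Ω × ℝ × ℝ => B j q.2.1 q.1 :=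
      (hBm j).comp (f := fun q : Ω × ℝ × ℝ => (q.2.1, q.1)) (by fun_prop)
    have h2 : Measurable fun q : Ω × ℝ × ℝ => B j (q.2.1 - q.2.2) q.1 :=
      (hBm j).comp (f := fun q : Ω × ℝ × ℝ => (q.2.1 - q.2.2, q.1)) (by fun_prop)
    unfold Function.uncurry
    simp only [F]
    fun_prop
  let κ : Measure (ℝ × ℝ) := (volume.restrict (Icc 0 T)).prod (volume.restrict (Ioi 0))
  have hbound : ∀ j, ∀ᵐ p ∂κ, ∫⁻ ω, F j ω p ∂P ≤
      ENNReal.ofReal (p.2 ^ (-(3 / 2) : ℝ) * min p.2 T) * ENNReal.ofReal (μ j) := fun j => by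
    have hpos : ∀ᵐ p ∂κ, 0 < p.2 :=
      Measure.quasiMeasurePreserving_snd.ae (ae_restrict_mem measurableSet_Ioi)
    filter_upwards [hpos] with p hp
    have hmin : 0 ≤ min p.2 T := le_min hp.le hT.le
    rw [lintegral_const_mul' _ _ ENNReal.ofReal_ne_top, ENNReal.ofReal_mul (by positivity),
      mul_assoc, ← ENNReal.ofReal_mul hmin]
    refine mul_le_mul_right (le_trans ?_
      (hW.lintegral_sq_noisePath_sub_le hT.le (hQ j) (hμ j) p.1 hp.le)) _
    refine lintegral_mono fun ω => ?_
    by_cases hω : ω ∈ G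
    · simp only [B, indicator_of_mem hω]; exact le_rfl
    · simp [B, indicator_of_notMem hω]
  have hC : ∫⁻ p, ENNReal.ofReal (p.2 ^ (-(3 / 2) : ℝ) * min p.2 T) ∂κ ≠ ⊤ := by
    rw [lintegral_prod _ (by fun_prop)]
    simp only [lintegral_const]
    exact ENNReal.mul_ne_top (integrableOn_rpow_mul_min hT).lintegral_lt_top.ne (by simp)
  have htot : ∫⁻ ω, ∑' j, ∫⁻ p, F j ω p ∂κ ∂P ≠ ⊤ := by
    rw [lintegral_tsum fun j => (Measurable.lintegral_prod_right (hFm j)).aemeasurable]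
    refine ne_top_of_le_ne_top (ENNReal.mul_ne_top hC hμs.tsum_ofReal_ne_top) ?_
    rw [← ENNReal.tsum_mul_left]
    refine ENNReal.tsum_le_tsum fun j => ?_
    rw [lintegral_lintegral_swap (hFm j).aemeasurable]
    refine (lintegral_mono_ae (hbound j)).trans (le_of_eq ?_)
    rw [lintegral_mul_const' _ _ ENNReal.ofReal_ne_top]
  have hfin := ae_lt_top' (Measurable.tsum fun j =>
    Measurable.lintegral_prod_right (hFm j)).aemeasurable htot
  have hGae : ∀ᵐ ω ∂P, ω ∈ G := hG0
  filter_upwards [hfin, hGae] with ω hω hωG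
  refine ne_of_eq_of_ne (tsum_congr fun j => ?_) hω.ne
  have hFω : AEMeasurable (F j ω) κ := ((hFm j).comp measurable_prodMk_left).aemeasurable
  rw [lintegral_prod _ hFω]
  refine lintegral_congr fun t => setLIntegral_congr_fun measurableSet_Ioi fun σ hσ => ?_
  simp only [F, B, indicator_of_mem hωG]
  rw [ENNReal.ofReal_mul (Real.rpow_nonneg (le_of_lt hσ) _)]

end Noise

/-! ### The state and its derivatives for a fixed noise path -/

theorem measurable_pathEnergy {b : ℝ → ℝ} (hb : Continuous b) : Measurable (pathEnergy b) := by
  refine (StronglyMeasurable.integral_prod_right (ν := volume.restrict (Ioi (0 : ℝ)))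
    (f := fun t σ => σ ^ (-(3 / 2) : ℝ) * (b t - b (t - σ)) ^ 2) ?_).measurable
  apply Measurable.stronglyMeasurable
  have := hb.measurable
  unfold Function.uncurry
  fun_prop

theorem ofReal_pathEnergy_le {b : ℝ → ℝ} (hb : Continuous b) (t : ℝ) :
    ENNReal.ofReal (pathEnergy b t) ≤
      ∫⁻ σ in Ioi (0 : ℝ), ENNReal.ofReal (σ ^ (-(3 / 2) : ℝ) * (b t - b (t - σ)) ^ 2) := by
  have hm := hb.measurable
  rw [pathEnergy, integral_eq_lintegral_of_nonneg_ae
    ((ae_restrict_mem measurableSet_Ioi).mono fun σ hσ =>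
      mul_nonneg (Real.rpow_nonneg (le_of_lt hσ) _) (sq_nonneg _))
    (Measurable.aestronglyMeasurable (by fun_prop))]
  exact ENNReal.ofReal_toReal_le

theorem pathEnergy_nonneg (b : ℝ → ℝ) (t : ℝ) : 0 ≤ pathEnergy b t :=
  setIntegral_nonneg measurableSet_Ioi fun _ hσ =>
    mul_nonneg (Real.rpow_nonneg (le_of_lt hσ) _) (sq_nonneg _)

theorem ae_pos_restrict_Icc (T : ℝ) : ∀ᵐ t ∂volume.restrict (Icc 0 T), 0 < t := by
  filter_upwards [ae_restrict_mem measurableSet_Icc, ae_restrict_of_ae (Measure.ae_ne volume 0)]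
    with t h1 h2
  exact lt_of_le_of_ne h1.1 h2.symm

theorem exists_state_derivatives {β : Type*} [MeasurableSpace β] {m : Measure β} [SFinite m]
    {e : ℕ → Lp ℝ 2 m} (he : Orthonormal ℝ e) {T : ℝ} {l c : ℕ → ℝ} {b : ℕ → ℝ → ℝ} {l₀ : ℝ}
    (hl : ∀ j, l₀ ≤ l j) (hc : Summable fun j => c j ^ 2) (hb : ∀ j, Continuous (b j))
    (hbM : ∀ j, ∃ M, ∀ t, |b j t| ≤ M)
    (hE : ∑' j, ∫⁻ t in Icc 0 T, ∫⁻ σ in Ioi (0 : ℝ), ENNReal.ofReal (σ ^ (-(3 / 2) : ℝ) *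
      (b j t - b j (t - σ)) ^ 2) ≠ ⊤) :
    ∃ S : ℕ → ℝ → Lp ℝ 2 (m.prod (volume.restrict (Icc 0 T))), ∀ n s, 0 < s →
      (∃ h : ∀ j, MemLp (fun p : β × ℝ => modeDeriv (l j) (c j) (b j) n s p.2 * e j p.1) 2
        (m.prod (volume.restrict (Icc 0 T))),
        HasSum (fun j => (h j).toLp) (S n s)) ∧ HasDerivAt (S n) (S (n + 1) s) s := by
  have hEj := ENNReal.ne_top_of_tsum_ne_top hE
  have hEm : ∀ j, Measurable fun t => ∫⁻ σ in Ioi (0 : ℝ), ENNReal.ofReal (σ ^ (-(3 / 2) : ℝ) *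
      (b j t - b j (t - σ)) ^ 2) := fun j => by
    have := (hb j).measurable
    refine Measurable.lintegral_prod_right (f := fun t σ : ℝ =>
      ENNReal.ofReal (σ ^ (-(3 / 2) : ℝ) * (b j t - b j (t - σ)) ^ 2)) ?_
    unfold Function.uncurry
    fun_prop
  have hint : ∀ j, ∀ᵐ t ∂volume.restrict (Icc 0 T), IntegrableOn
      (fun σ => σ ^ (-(3 / 2) : ℝ) * (b j t - b j (t - σ)) ^ 2) (Ioi 0) := fun j => by
    filter_upwards [ae_lt_top (hEm j) (hEj j)] with t ht
    have := (hb j).measurable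
    refine (lintegral_ofReal_ne_top_iff_integrable
      (Measurable.aestronglyMeasurable (by fun_prop)) ?_).1 ht.ne
    exact (ae_restrict_mem measurableSet_Ioi).mono fun σ hσ =>
      mul_nonneg (Real.rpow_nonneg (le_of_lt hσ) _) (sq_nonneg _)
  have hle : ∀ j, ∫⁻ t in Icc 0 T, ENNReal.ofReal (pathEnergy (b j) t) ≤
      ∫⁻ t in Icc 0 T, ∫⁻ σ in Ioi (0 : ℝ), ENNReal.ofReal (σ ^ (-(3 / 2) : ℝ) *
        (b j t - b j (t - σ)) ^ 2) := fun j =>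
    lintegral_mono fun t => ofReal_pathEnergy_le (hb j) t
  have hpI : ∀ j, IntegrableOn (pathEnergy (b j)) (Icc 0 T) := fun j =>
    (lintegral_ofReal_ne_top_iff_integrable (measurable_pathEnergy (hb j)).aestronglyMeasurable
      (Eventually.of_forall (pathEnergy_nonneg (b j)))).1 (ne_top_of_le_ne_top (hEj j) (hle j))
  have hpS : Summable fun j => ∫ t in Icc 0 T, pathEnergy (b j) t := by
    refine Summable.of_nonneg_of_le
      (fun j => integral_nonneg (pathEnergy_nonneg (b j))) (fun j => ?_)
      (ENNReal.summable_toReal hE)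
    rw [integral_eq_lintegral_of_nonneg_ae (Eventually.of_forall (pathEnergy_nonneg (b j)))
      (measurable_pathEnergy (hb j)).aestronglyMeasurable]
    exact ENNReal.toReal_mono (hEj j) (hle j)
  have hsq : ∀ t ∈ Icc 0 T, (t ^ (-(1 / 4) : ℝ)) ^ 2 = t ^ (-(1 / 2) : ℝ) := fun t ht => by
    rw [← Real.rpow_natCast, ← Real.rpow_mul ht.1]; norm_num
  have htI : IntegrableOn (fun t : ℝ => t ^ (-(1 / 2) : ℝ)) (Icc 0 T) := by
    rcases le_or_gt 0 T with hT | hT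
    · rw [integrableOn_Icc_iff_integrableOn_Ioc,
        ← intervalIntegrable_iff_integrableOn_Ioc_of_le hT]
      exact intervalIntegral.intervalIntegrable_rpow' (by norm_num)
    · simp [Icc_eq_empty_of_lt hT]
  have ht2 : MemLp (fun t : ℝ => t ^ (-(1 / 4) : ℝ)) 2 (volume.restrict (Icc 0 T)) :=
    (memLp_two_iff_integrable_sq (Measurable.aestronglyMeasurable (by fun_prop))).2
      (IntegrableOn.congr_fun htI (fun t ht => (hsq t ht).symm) measurableSet_Icc)
  have hp2 : ∀ j, MemLp (fun t => √(pathEnergy (b j) t)) 2 (volume.restrict (Icc 0 T)) :=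
    fun j => by
      refine (memLp_two_iff_integrable_sq
        (measurable_pathEnergy (hb j)).sqrt.aestronglyMeasurable).2 ?_
      simp only [Real.sq_sqrt (pathEnergy_nonneg _ _)]
      exact hpI j
  have hg : ∀ j, MemLp (fun t => |c j| * t ^ (-(1 / 4) : ℝ) + √(pathEnergy (b j) t)) 2
      (volume.restrict (Icc 0 T)) := fun j => (ht2.const_mul _).add (hp2 j)
  refine exists_hasDerivAt_orthogonal_series he
    (fun n j s t => modeDeriv (l j) (c j) (b j) n s t)
    (fun j t => |c j| * t ^ (-(1 / 4) : ℝ) + √(pathEnergy (b j) t))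
    (fun n j s => (measurable_modeDeriv (hb j) (l j) (c j) n s).aestronglyMeasurable)
    (fun n j s t => ?_) hg ?_ fun n s₀ s₁ hs₀ => ?_
  · obtain ⟨M, hM⟩ := hbM j
    exact hasDerivAt_modeDeriv (hb j) hM (l j) (c j) n s t
  -- From (p + q)² ≤ 2p² + 2q²: the squared norms are dominated by ∑ c_j² and the summable energies.
  · refine Summable.of_nonneg_of_le (fun j => integral_nonneg fun t => sq_nonneg _) (fun j => ?_)
      (((hc.mul_left 2).mul_right (∫ t in Icc 0 T, t ^ (-(1 / 2) : ℝ))).add (hpS.mul_left 2))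
    rw [← integral_const_mul, ← integral_const_mul,
      ← integral_add (htI.const_mul _) ((hpI j).const_mul _)]
    refine integral_mono_ae (hg j).integrable_sq
      ((htI.const_mul _).add ((hpI j).const_mul _)) ?_
    filter_upwards [ae_restrict_mem measurableSet_Icc] with t ht
    have h1 := add_sq_le (a := |c j| * t ^ (-(1 / 4) : ℝ)) (b := √(pathEnergy (b j) t))
    rw [mul_pow, sq_abs, hsq t ht, Real.sq_sqrt (pathEnergy_nonneg _ _)] at h1
    linarith
  · obtain ⟨C, hC, hCb⟩ := exists_abs_modeDeriv_le n
    obtain ⟨K, hK, hKb⟩ := exists_pow_mul_exp_neg_le n l₀ hs₀ s₁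
    refine ⟨C * K, by positivity, fun j => ?_⟩
    filter_upwards [hint j, ae_pos_restrict_Icc T] with t hti ht s hs
    refine (hCb (l j) (c j) (b j) (hb j) s t ht hti).trans ?_
    gcongr
    exact hKb (l j) (hl j) s hs.1 hs.2

theorem fderiv_fderiv_of_hasDerivAt {F : Type*} [NormedAddCommGroup F] [NormedSpace ℝ F]
    {S S₁ S₂ : ℝ → F} (h₁ : ∀ s, 0 < s → HasDerivAt S (S₁ s) s)
    (h₂ : ∀ s, 0 < s → HasDerivAt S₁ (S₂ s) s) {s : ℝ} (hs : 0 < s) :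
    DifferentiableAt ℝ S s ∧ DifferentiableAt ℝ (fderiv ℝ S) s ∧
      (∀ h : ℝ, fderiv ℝ S s h = h • S₁ s) ∧
      ∀ h k : ℝ, fderiv ℝ (fderiv ℝ S) s h k = (h * k) • S₂ s := by
  have hf : ∀ r, 0 < r → fderiv ℝ S r = ContinuousLinearMap.toSpanSingleton ℝ (S₁ r) :=
    fun r hr => (h₁ r hr).hasFDerivAt.fderiv
  have hev : fderiv ℝ S =ᶠ[𝓝 s] fun r => ContinuousLinearMap.toSpanSingletonCLE (𝕜 := ℝ) (S₁ r) :=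
    (lt_mem_nhds hs).mono fun r hr => hf r hr
  have h3 := ((ContinuousLinearMap.toSpanSingletonCLE (𝕜 := ℝ) (E := F)).hasFDerivAt.comp_hasDerivAt
    s (h₂ s hs)).congr_of_eventuallyEq hev
  refine ⟨(h₁ s hs).differentiableAt, h3.differentiableAt, fun h => ?_, fun h k => ?_⟩
  · rw [hf s hs, ContinuousLinearMap.toSpanSingleton_apply]
  · rw [h3.hasFDerivAt.fderiv]
    simp [smul_smul]

theorem IsEigenSeries.of_eq_on {d : ℕ} {D : Set (EuclideanSpace ℝ (Fin d))} {T : ℝ}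
    {e : HilbertBasis ℕ ℝ (SpaceL2 D)} {f g : ℕ → ℝ → ℝ} {z : CylinderL2 D T}
    (hg : IsEigenSeries e g z) (hfg : ∀ j, ∀ t ∈ Icc 0 T, f j t = g j t) :
    IsEigenSeries e f z := by
  obtain ⟨h, hz⟩ := hg
  have hae : ∀ j, (fun p : EuclideanSpace ℝ (Fin d) × ℝ => g j p.2 * e j p.1)
      =ᵐ[cylinderMeasure D T] fun p => f j p.2 * e j p.1 := fun j => by
    filter_upwards [Measure.quasiMeasurePreserving_snd.ae (ae_restrict_mem measurableSet_Icc)]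
      with p hp
    rw [hfg j _ hp]
  refine ⟨fun j => (h j).ae_eq (hae j), hz.congr_fun fun j => ?_⟩
  exact (MemLp.toLp_eq_toLp_iff _ _).2 (hae j).symm

/-! ### Existence of adapted modes -/

section Existence

variable {H : Type*} [NormedAddCommGroup H] [InnerProductSpace ℝ H]
  {Ω : Type*} {mΩ : MeasurableSpace Ω} {e : HilbertBasis ℕ ℝ H} {μ : ℕ → ℝ} {T : ℝ}
  {W : ℝ → Ω → H} {ℱ : Filtration ℝ mΩ} {P : Measure Ω} {Q : H →L[ℝ] H}

theorem stronglyMeasurable_duhamel {m : MeasurableSpace Ω} {B : Ω → ℝ → ℝ}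
    (hBc : ∀ ω, Continuous (B ω)) {t : ℝ} (ht : 0 ≤ t)
    (hBm : ∀ r ≤ t, StronglyMeasurable fun ω => B ω r) (a c : ℝ) :
    StronglyMeasurable fun ω => duhamel a c (B ω) t := by
  -- Stopping the path at time t leaves the integral unchanged and uses only values of B up to t,
  -- which keeps the solution adapted.
  have h : StronglyMeasurable fun ω => ∫ τ in Ioc 0 t, Real.exp (a * τ) * B ω (min τ t) := by
    have hu : StronglyMeasurable (Function.uncurry fun τ ω => B ω (min τ t)) :=
      stronglyMeasurable_uncurry_of_continuous_of_stronglyMeasurable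
        (fun ω => (hBc ω).comp (by fun_prop)) fun τ => hBm _ (min_le_right τ t)
    have he : StronglyMeasurable fun p : ℝ × Ω => Real.exp (a * p.1) :=
      Measurable.stronglyMeasurable (by fun_prop)
    exact StronglyMeasurable.integral_prod_left
      (f := fun τ ω => Real.exp (a * τ) * B ω (min τ t)) (he.mul hu)
  have e1 : ∀ ω, ∫ τ in (0 : ℝ)..t, Real.exp (a * τ) * B ω τ =
      ∫ τ in Ioc 0 t, Real.exp (a * τ) * B ω (min τ t) := fun ω => by
    rw [intervalIntegral.integral_of_le ht]
    refine setIntegral_congr_fun measurableSet_Ioc fun τ hτ => ?_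
    simp only [min_eq_left hτ.2]
  unfold duhamel
  simp only [e1]
  exact ((stronglyMeasurable_const.sub (h.const_mul a)).const_mul _).add (hBm t le_rfl)

theorem IsQWienerProcess.exists_isModeFamily (hW : IsQWienerProcess Q T ℱ P W) (hT : 0 ≤ T)
    (hℱ : IsNormalFiltration ℱ P T) (lam : ℕ → ℝ) (y₀ : H) :
    ∃ y : ℕ → ℝ → ℝ → Ω → ℝ, IsModeFamily e lam μ y₀ T ℱ P W y := by
  classical
  obtain ⟨G, hGm, hG0, hG⟩ := hW.exists_measurableSet_isGoodPath
  -- Normality of the filtration enters here: discarding the bad paths does not destroy adaptedness.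
  have hGℱ : MeasurableSet[ℱ 0] G := by
    simpa using (hℱ.null_sets _ hGm.compl hG0).compl
  let B : ℕ → Ω → ℝ → ℝ := fun j ω t => G.indicator (fun ω => noisePath e μ T W j ω t) ω
  have hBG : ∀ j, ∀ ω ∈ G, B j ω = noisePath e μ T W j ω := fun j ω hω =>
    funext fun t => indicator_of_mem hω _
  have hBc : ∀ j ω, Continuous (B j ω) := fun j ω => by
    by_cases hω : ω ∈ G
    · rw [hBG j ω hω]
      exact (hG ω hω).continuous_noisePath hT j
    · simpa only [B, indicator_of_notMem hω] using continuous_const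
  refine ⟨fun j s t ω => duhamel (lam j ^ s) ⟪e j, y₀⟫ (B j ω) t, fun j s hs t ht => ?_, ?_⟩
  · refine stronglyMeasurable_duhamel (hBc j) ht.1 (fun r hr => ?_) _ _
    refine StronglyMeasurable.indicator ?_ (ℱ.mono ht.1 _ hGℱ)
    exact (hW.stronglyMeasurable_noisePath hT j r).mono
      (ℱ.mono (max_le ht.1 ((min_le_left _ _).trans hr)))
  · have hGae : ∀ᵐ ω ∂P, ω ∈ G := hG0
    filter_upwards [hGae] with ω hω s hs j
    refine ⟨(continuous_duhamel _ _ (hBc j ω)).continuousOn, fun t ht => ?_⟩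
    rw [← noisePath_of_mem_Icc j ω ht, ← hBG j ω hω]
    exact duhamel_eq _ _ (hBc j ω) t

end Existence

/-! ### Positivity of the eigenvalues and the main theorem -/

theorem IsPositiveWithCompactInverse.eigenvalue_pos {H : Type*} [NormedAddCommGroup H]
    [InnerProductSpace ℝ H] [CompleteSpace H] {A : H →ₗ.[ℝ] H}
    (hA : IsPositiveWithCompactInverse A) {e : HilbertBasis ℕ ℝ H} {lam : ℕ → ℝ}
    (he : IsEigenbasis A e lam) (j : ℕ) : 0 < lam j := by
  obtain ⟨h, hj⟩ := he.apply_eq j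
  have h1 := hA.positive ⟨e j, h⟩ (e.orthonormal.ne_zero j)
  rw [hj, real_inner_smul_left, real_inner_self_eq_norm_sq, e.orthonormal.1 j] at h1
  simpa using h1

theorem mainTheorem3 {d : ℕ} (D : Set (EuclideanSpace ℝ (Fin d))) (hD_open : IsOpen D)
    (hD_conn : IsConnected D) (hD_bdd : Bornology.IsBounded D) (T : ℝ) (hT : 0 < T)
    -- the operator, its eigenfunctions and its eigenvalues
    (A : SpaceL2 D →ₗ.[ℝ] SpaceL2 D) (hA : IsPositiveWithCompactInverse A)
    (e : HilbertBasis ℕ ℝ (SpaceL2 D)) (lam : ℕ → ℝ) (he : IsEigenbasis A e lam)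
    -- the trace-class covariance operator, diagonal in the same basis
    (Q : SpaceL2 D →L[ℝ] SpaceL2 D) (hQ : Q.IsPositive) (μ : ℕ → ℝ)
    (hQe : ∀ j, Q (e j) = μ j • e j) (hQ_trace : Summable μ)
    -- the noise
    {Ω : Type*} {mΩ : MeasurableSpace Ω} (P : Measure Ω) [IsProbabilityMeasure P]
    (ℱ : Filtration ℝ mΩ) (hℱ : IsNormalFiltration ℱ P T)
    (W : ℝ → Ω → SpaceL2 D) (hW : IsQWienerProcess Q T ℱ P W)
    -- the deterministic initial condition
    (y₀ : SpaceL2 D) :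
    (∃ y : ℕ → ℝ → ℝ → Ω → ℝ, IsModeFamily e lam μ y₀ T ℱ P W y) ∧
    ∀ y : ℕ → ℝ → ℝ → Ω → ℝ, IsModeFamily e lam μ y₀ T ℱ P W y →
      ∀ᵐ ω ∂P,
        -- the modes can be differentiated twice in `s`
        (∀ s, 0 < s → ∀ j, ∀ t ∈ Icc 0 T,
          DifferentiableAt ℝ (fun r => y j r t ω) s ∧
          DifferentiableAt ℝ (deriv fun r => y j r t ω) s) ∧
        -- the state `S s = y(s)` and its termwise derivatives `S₁ s`, `S₂ s`
        ∃ S S₁ S₂ : ℝ → CylinderL2 D T, ∀ s, 0 < s →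
          IsEigenSeries e (fun j t => y j s t ω) (S s) ∧
          IsEigenSeries e (fun j t => deriv (fun r => y j r t ω) s) (S₁ s) ∧
          IsEigenSeries e (fun j t => deriv (deriv fun r => y j r t ω) s) (S₂ s) ∧
          DifferentiableAt ℝ S s ∧
          DifferentiableAt ℝ (fderiv ℝ S) s ∧
          (∀ h : ℝ, fderiv ℝ S s h = h • S₁ s) ∧
          ∀ h k : ℝ, fderiv ℝ (fderiv ℝ S) s h k = (h * k) • S₂ s := by
  have hlam : ∀ j, 0 < lam j := hA.eigenvalue_pos he
  have hμ : ∀ j, 0 ≤ μ j := fun j => by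
    have h := hQ.inner_nonneg_left (e j)
    rw [hQe, real_inner_smul_left, real_inner_self_eq_norm_sq, e.orthonormal.1 j] at h
    simpa using h
  refine ⟨hW.exists_isModeFamily hT.le hℱ lam y₀, fun y hy => ?_⟩
  filter_upwards [hy.solves, hW.ae_isGoodPath,
    hW.ae_tsum_lintegral_energy_ne_top hT hQe hμ hQ_trace] with ω hsol hgood hE
  set c : ℕ → ℝ := fun j => ⟪e j, y₀⟫
  set b : ℕ → ℝ → ℝ := fun j => noisePath e μ T W j ω
  set l : ℕ → ℝ := fun j => Real.log (lam j)
  have hb : ∀ j, Continuous (b j) := hgood.continuous_noisePath hT.le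
  have hbM : ∀ j, ∃ M, ∀ t, |b j t| ≤ M := hgood.exists_abs_noisePath_le hT.le
  have hc : Summable fun j => c j ^ 2 := by
    simpa [c] using e.orthonormal.inner_products_summable y₀
  -- The smallest eigenvalue supplies the lower bound on log λ_j that makes the estimates uniform in
  -- j.
  have hl : ∀ j, l 0 ≤ l j := fun j => Real.log_le_log (hlam 0) (he.monotone (Nat.zero_le j))
  have hy0 : ∀ j s, 0 < s → ∀ t ∈ Icc 0 T, y j s t ω = modeDeriv (l j) (c j) (b j) 0 s t := by
    intro j s hs t ht
    obtain ⟨M, hM⟩ := hbM j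
    rw [← duhamel_eq_modeDeriv (l j) (c j) (hb j) hM
      (fun r hr => hgood.noisePath_of_nonpos hT.le j hr) s ht.1]
    refine eq_duhamel (hb j) (hsol s hs j).1 (fun r hr => ?_) ht
    rw [(hsol s hs j).2 r hr, ← noisePath_of_mem_Icc j ω hr,
      Real.rpow_def_of_pos (hlam j), mul_comm s]
  have hd : ∀ n j s t, HasDerivAt (fun r => modeDeriv (l j) (c j) (b j) n r t)
      (modeDeriv (l j) (c j) (b j) (n + 1) s t) s := fun n j s t => by
    obtain ⟨M, hM⟩ := hbM j
    exact hasDerivAt_modeDeriv (hb j) hM _ _ n s t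
  have hd1 : ∀ j, ∀ t ∈ Icc 0 T, ∀ s, 0 < s → HasDerivAt (fun r => y j r t ω)
      (modeDeriv (l j) (c j) (b j) 1 s t) s := fun j t ht s hs =>
    (hd 0 j s t).congr_of_eventuallyEq ((lt_mem_nhds hs).mono fun r hr => hy0 j r hr t ht)
  have hd2 : ∀ j, ∀ t ∈ Icc 0 T, ∀ s, 0 < s → HasDerivAt (deriv fun r => y j r t ω)
      (modeDeriv (l j) (c j) (b j) 2 s t) s := fun j t ht s hs =>
    (hd 1 j s t).congr_of_eventuallyEq
      ((lt_mem_nhds hs).mono fun r hr => (hd1 j t ht r hr).deriv)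
  obtain ⟨S, hS⟩ := exists_state_derivatives e.orthonormal hl hc hb hbM hE
  refine ⟨fun s hs j t ht => ⟨(hd1 j t ht s hs).differentiableAt,
    (hd2 j t ht s hs).differentiableAt⟩, S 0, S 1, S 2, fun s hs => ⟨?_, ?_, ?_, ?_⟩⟩
  · exact IsEigenSeries.of_eq_on (hS 0 s hs).1 fun j t ht => hy0 j s hs t ht
  · exact IsEigenSeries.of_eq_on (hS 1 s hs).1 fun j t ht => (hd1 j t ht s hs).deriv
  · exact IsEigenSeries.of_eq_on (hS 2 s hs).1 fun j t ht => (hd2 j t ht s hs).deriv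
  · exact fderiv_fderiv_of_hasDerivAt (fun r hr => (hS 0 r hr).2) (fun r hr => (hS 1 r hr).2) hs
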